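/- Let $G$ be a finite abelian group (written additively). A sequence over a set is a finite unordered list of elements, repetition allowed; $|S|$ denotes its length, $\mathrm{supp}(S)$ the set of its terms, and $g'+S$ the sequence obtained by adding $g'$ to every term. For a sequence $W$ of integers and a sequence $S$ over $G$, put $$W\odot S=\{w_1g_1+\cdots+w_rg_r:\ w_1\cdots w_r \text{ a subsequence of } W,\ g_1\cdots g_r\text{ a subsequence of } S,\ r=\min\{|W|,|S|\}\}.$$ Let $S$ be a sequence over $G$ whose terms are not all contained in a coset of a proper subgroup of $G$, and let $W$ be a sequence of $|S|$ consecutive integers. Then: 1. $|W\odot S|\ge \min\{|G|-1,\,|S|\}$. 2. If $|S|\ge |G|+1$, then $W\odot S=G$; moreover there is a subsequence $S'$ of $S$ with $|S'|=|G|$ such that $W'\odot S'=G$, where $W'$ is the sequence $0,1,\ldots,|G|-1$. 3. If $|S|=|G|$ and $W\odot S\ne G$, then $|G|\ge 3$ and one of the following holds: (i) $G\cong C_2\oplus C_2$, $|\mathrm{supp}(S)|=|S|=|G|=4$ and $W\odot S=G\setminus\{0\}$; (ii) $G$ is cyclic, and there are $g,g'\in G$ with $\mathrm{ord}(g)=|G|$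 such that $-g'+S$ consists of $|G|-2$ terms equal to $0$ together with the two further terms $g$ and $-g$, and $W\odot S=G\setminus\left\{\tfrac{(|G|-1)|G|}{2}\,g'\right\}$; in particular, $W\odot S$ contains every $h\in G$ that generates $G$. -/

import Mathlib

/-- The weighted sumset `W ⊙ S` of a (finite, unordered) sequence `W` of integers and a sequence
`S` over `G`: all `w₁ g₁ + ⋯ + wᵣ gᵣ` with `w₁ ⋯ wᵣ ∣ W`, `g₁ ⋯ gᵣ ∣ S` and `r = min (|W|, |S|)`.
The multiset `P` is the collection of the pairs `(wᵢ, gᵢ)`. -/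
def weightedSumset {G : Type*} [AddCommGroup G] (W : Multiset ℤ) (S : Multiset G) : Set G :=
  {x | ∃ P : Multiset (ℤ × G),
    P.map Prod.fst ≤ W ∧ P.map Prod.snd ≤ S ∧ P.card = min W.card S.card ∧
      x = (P.map fun p => p.1 • p.2).sum}

/-- The sequence `a, a + 1, …, a + n - 1` of `n` consecutive integers. -/
def consecutiveIntegers (a : ℤ) (n : ℕ) : Multiset ℤ :=
  (Multiset.range n).map fun i => a + (i : ℤ)

/-- All terms of `S` lie in one coset `x + H` of a proper subgroup `H` of `G`. -/
def InCosetOfProperSubgroup {G : Type*} [AddCommGroup G] (S : Multiset G) : Prop :=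
  ∃ H : AddSubgroup G, H ≠ ⊤ ∧ ∃ x : G, ∀ s ∈ S, s - x ∈ H

/-! ### Sums weighted by permutations of consecutive integers -/

section WeightedSums

variable {G : Type*} [AddCommGroup G]

/-! Shifting all weights by `a` translates the sums by `a • S.sum`, so it suffices to study `apSums
S`, with weights `0, …, |S| - 1`. The coset hypothesis says `spanDiff S = ⊤`. The lower bound and
the full subsequence are proved together by induction on `|G|`.

Lower bound: take a shortest `S`, of length `n < |G|`, for which `X = apSums S` is too small. If
deleting a term `h` left a sequence in a coset of a proper subgroup `K`, the weight of `h` would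
select a coset of `K`, and induction inside these cosets would give enough sums. So every deletion
still spans, and by minimality `X` is a translate of the sums of the rest. Comparing the top and
bottom weights for the deleted `g` gives `X` the period `S.sum - n • g`. Exchanging `g` and `h` on
the two top weights shows that at most one point of `X` leaves it when `g - h` is subtracted. A
nontrivial set with this property in generating directions has no nonzero period, so `n • (g - h) =
0` and no difference generates `G`. Hence there are two independent directions, and
`subsingleton_or_compl_of_smallBoundary` leaves `X` or its complement at most one point, which the
cardinalities exclude.

Length `|G|`: the lowest and the highest weight for one term give two shifts of a set of at least
`|G| - 1` sums. They differ when `S.sum ≠ 0`, and pigeonhole then yields all of `G`; with a spare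
term, an exchange makes the sum nonzero. When `S.sum = 0`, three suitable terms with four sums
(`apSums_eq_univ_of_triple`) or two terms whose difference has order two
(`apSums_eq_univ_of_order_two`) still fill `G`, apart from the listed exceptions. -/

theorem mem_weightedSumset_iff {W : Multiset ℤ} {S : Multiset G} (h : W.card = S.card) {x : G} :
    x ∈ weightedSumset W S ↔ ∃ P : Multiset (ℤ × G), P.map Prod.fst = W ∧ P.map Prod.snd = S ∧
      x = (P.map fun p => p.1 • p.2).sum := by
  constructor
  · rintro ⟨P, h1, h2, h3, h4⟩
    refine ⟨P, Multiset.eq_of_le_of_card_le h1 ?_, Multiset.eq_of_le_of_card_le h2 ?_, h4⟩ <;>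
      simp [h3, h]
  · rintro ⟨P, h1, h2, h4⟩
    refine ⟨P, h1.le, h2.le, ?_, h4⟩
    rw [← h1, ← h2]; simp

theorem add_mem_weightedSumset {W W' : Multiset ℤ} {S S' : Multiset G} (h : W.card = S.card)
    (h' : W'.card = S'.card) {x y : G} (hx : x ∈ weightedSumset W S)
    (hy : y ∈ weightedSumset W' S') : x + y ∈ weightedSumset (W + W') (S + S') := by
  rw [mem_weightedSumset_iff h] at hx
  rw [mem_weightedSumset_iff h'] at hy
  rw [mem_weightedSumset_iff (by simp [h, h'])]
  obtain ⟨P, rfl, rfl, rfl⟩ := hx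
  obtain ⟨Q, rfl, rfl, rfl⟩ := hy
  exact ⟨P + Q, by simp, by simp, by simp⟩

theorem shift_mem_weightedSumset {W : Multiset ℤ} {S : Multiset G} (h : W.card = S.card) (a : ℤ)
    {x : G} (hx : x ∈ weightedSumset W S) :
    a • S.sum + x ∈ weightedSumset (W.map fun w => a + w) S := by
  rw [mem_weightedSumset_iff h] at hx
  rw [mem_weightedSumset_iff (by simp [h])]
  obtain ⟨P, rfl, rfl, rfl⟩ := hx
  refine ⟨P.map fun p => (a + p.1, p.2), by simp, by simp, ?_⟩
  simp [add_smul, Multiset.sum_map_add, Multiset.sum_map_zsmul]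

theorem translate_mem_weightedSumset {W : Multiset ℤ} {S : Multiset G} (h : W.card = S.card)
    (g : G) {x : G} (hx : x ∈ weightedSumset W S) :
    W.sum • g + x ∈ weightedSumset W (S.map fun s => g + s) := by
  rw [mem_weightedSumset_iff h] at hx
  rw [mem_weightedSumset_iff (by simp [h])]
  obtain ⟨P, rfl, rfl, rfl⟩ := hx
  refine ⟨P.map fun p => (p.1, g + p.2), by simp, by simp, ?_⟩
  have : (P.map fun p => p.1 • g).sum = (P.map Prod.fst).sum • g := by
    induction P using Multiset.induction with
    | empty => simp
    | cons a P ih => simp_all [add_smul]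
  simp [Multiset.sum_map_add, this]

theorem map_mem_weightedSumset {H : Type*} [AddCommGroup H] (φ : G →+ H) {W : Multiset ℤ}
    {S : Multiset G} (h : W.card = S.card) {x : G} (hx : x ∈ weightedSumset W S) :
    φ x ∈ weightedSumset W (S.map φ) := by
  rw [mem_weightedSumset_iff h] at hx
  rw [mem_weightedSumset_iff (by simp [h])]
  obtain ⟨P, rfl, rfl, rfl⟩ := hx
  exact ⟨P.map fun p => (p.1, φ p.2), by simp, by simp, by simp [map_multiset_sum]⟩

/-- Serves to pull sums in a quotient back to `G`: weights matched with the images of the terms can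
be matched with the terms themselves. -/
theorem exists_lift_pairs {α β γ : Type*} (f : β → γ) (S : Multiset β) :
    ∀ P : Multiset (α × γ), P.map Prod.snd = S.map f →
      ∃ Q : Multiset (α × β), Q.map (fun p => (p.1, f p.2)) = P ∧ Q.map Prod.snd = S := by
  induction S using Multiset.induction with
  | empty =>
    intro P hP
    exact ⟨0, by simpa [eq_comm] using hP, by simp⟩
  | cons a S ih =>
    intro P hP
    have : f a ∈ P.map Prod.snd := by rw [hP]; simp
    obtain ⟨p, hp, hpa⟩ := Multiset.mem_map.1 this
    obtain ⟨P, rfl⟩ := Multiset.exists_cons_of_mem hp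
    rw [Multiset.map_cons, Multiset.map_cons, hpa, Multiset.cons_inj_right] at hP
    obtain ⟨Q, rfl, rfl⟩ := ih P hP
    exact ⟨(p.1, a) ::ₘ Q, by simp [← hpa], by simp⟩

theorem exists_of_mem_weightedSumset_map {H : Type*} [AddCommGroup H] (φ : G →+ H)
    {W : Multiset ℤ} {S : Multiset G} (h : W.card = S.card) {y : H}
    (hy : y ∈ weightedSumset W (S.map φ)) : ∃ x ∈ weightedSumset W S, φ x = y := by
  rw [mem_weightedSumset_iff (by simp [h])] at hy
  obtain ⟨P, h1, h2, rfl⟩ := hy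
  obtain ⟨Q, rfl, rfl⟩ := exists_lift_pairs φ S P h2
  refine ⟨_, (mem_weightedSumset_iff h).2 ⟨Q, ?_, rfl, rfl⟩, ?_⟩
  · rw [← h1]; simp
  · simp [map_multiset_sum]

@[simp]
theorem card_consecutiveIntegers (a : ℤ) (n : ℕ) : (consecutiveIntegers a n).card = n := by
  simp [consecutiveIntegers]

theorem consecutiveIntegers_shift (a b : ℤ) (n : ℕ) :
    (consecutiveIntegers b n).map (fun w => a + w) = consecutiveIntegers (a + b) n := by
  simp [consecutiveIntegers, add_assoc]

theorem consecutiveIntegers_add (m n : ℕ) :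
    consecutiveIntegers 0 (m + n) = consecutiveIntegers 0 m + consecutiveIntegers m n := by
  simp [consecutiveIntegers, Multiset.range_add]

/-- The sums of the terms of `S` weighted by a permutation of `0, 1, …, |S| - 1`. -/
def apSums (S : Multiset G) : Set G := weightedSumset (consecutiveIntegers 0 S.card) S

theorem add_mem_apSums {S T : Multiset G} {x y : G} (hx : x ∈ apSums S) (hy : y ∈ apSums T) :
    x + (S.card • T.sum + y) ∈ apSums (S + T) := by
  unfold apSums
  rw [Multiset.card_add, consecutiveIntegers_add]
  refine add_mem_weightedSumset (by simp) (by simp) hx ?_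
  have := shift_mem_weightedSumset (by simp) (S.card : ℤ) hy
  rw [consecutiveIntegers_shift] at this
  simpa using this

theorem zero_mem_apSums_singleton (g : G) : (0 : G) ∈ apSums {g} :=
  (mem_weightedSumset_iff (by simp)).2 ⟨{(0, g)}, by simp [consecutiveIntegers], by simp, by simp⟩

theorem zero_mem_apSums_zero : (0 : G) ∈ apSums (0 : Multiset G) :=
  (mem_weightedSumset_iff (by simp)).2 ⟨0, by simp [consecutiveIntegers], by simp, by simp⟩

theorem apSums_nonempty (S : Multiset G) : (apSums S).Nonempty := by
  induction S using Multiset.induction with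
  | empty => exact ⟨0, zero_mem_apSums_zero⟩
  | cons a S ih =>
    obtain ⟨x, hx⟩ := ih
    exact ⟨_, add_mem_apSums (zero_mem_apSums_singleton a) hx⟩

/-- Give the term `g` the largest weight. -/
theorem add_top_mem_apSums {S : Multiset G} {x : G} (g : G) (hx : x ∈ apSums S) :
    x + S.card • g ∈ apSums (g ::ₘ S) := by
  have := add_mem_apSums hx (zero_mem_apSums_singleton g)
  simpa [add_comm S, Multiset.singleton_add] using this

/-- Give the term `g` the weight `0`. -/
theorem add_bot_mem_apSums {S : Multiset G} {x : G} (g : G) (hx : x ∈ apSums S) :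
    x + S.sum ∈ apSums (g ::ₘ S) := by
  have := add_mem_apSums (zero_mem_apSums_singleton g) hx
  rw [Multiset.singleton_add] at this
  simpa [add_comm x] using this

/-- Give the term `g` an intermediate weight. -/
theorem add_mid_mem_apSums {S T : Multiset G} {x y : G} (g : G) (hx : x ∈ apSums S)
    (hy : y ∈ apSums T) :
    x + S.card • g + ((S.card + 1) • T.sum + y) ∈ apSums (g ::ₘ (S + T)) := by
  simpa using add_mem_apSums (add_top_mem_apSums g hx) hy

theorem map_mem_apSums {H : Type*} [AddCommGroup H] (φ : G →+ H) {S : Multiset G} {x : G}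
    (hx : x ∈ apSums S) : φ x ∈ apSums (S.map φ) := by
  unfold apSums
  rw [Multiset.card_map]
  exact map_mem_weightedSumset φ (by simp) hx

theorem exists_of_mem_apSums_map {H : Type*} [AddCommGroup H] (φ : G →+ H)
    {S : Multiset G} {y : H} (hy : y ∈ apSums (S.map φ)) : ∃ x ∈ apSums S, φ x = y := by
  unfold apSums at hy
  rw [Multiset.card_map] at hy
  exact exists_of_mem_weightedSumset_map φ (by simp) hy

theorem exists_translate_apSums (S : Multiset G) (g : G) :
    ∃ c : G, ∀ x ∈ apSums S, c + x ∈ apSums (S.map fun s => g + s) := by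
  refine ⟨(consecutiveIntegers 0 S.card).sum • g, fun x hx => ?_⟩
  unfold apSums
  rw [Multiset.card_map]
  exact translate_mem_weightedSumset (by simp) g hx

theorem weightedSumset_consecutiveIntegers (a : ℤ) (S : Multiset G) :
    weightedSumset (consecutiveIntegers a S.card) S = (fun x => a • S.sum + x) '' apSums S := by
  ext x
  constructor
  · intro hx
    refine ⟨(-a) • S.sum + x, ?_, by simp⟩
    have := shift_mem_weightedSumset (by simp) (-a) hx
    rwa [consecutiveIntegers_shift, neg_add_cancel] at this
  · rintro ⟨y, hy, rfl⟩
    have := shift_mem_weightedSumset (by simp) a hy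
    rwa [consecutiveIntegers_shift, add_zero] at this

/-- One fixed arrangement of the remaining terms on the top weights embeds the smaller set of sums
by a translation. -/
theorem ncard_apSums_le_of_le [Finite G] {S T : Multiset G} (h : S ≤ T) :
    (apSums S).ncard ≤ (apSums T).ncard := by
  obtain ⟨R, rfl⟩ := Multiset.le_iff_exists_add.1 h
  obtain ⟨y, hy⟩ := apSums_nonempty R
  exact Set.ncard_le_ncard_of_injOn (fun x => x + (S.card • R.sum + y))
    (fun x hx => add_mem_apSums hx hy) (fun a _ b _ hab => by simpa using hab)

theorem eq_univ_of_card_le {α : Type*} [Finite α] {X : Set α} (h : Nat.card α ≤ X.ncard) : X = Set.univ :=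
  Set.eq_of_subset_of_ncard_le (Set.subset_univ X) (by rwa [Set.ncard_univ])

variable [Finite G]

theorem apSums_eq_univ_of_le {S T : Multiset G} (h : S ≤ T) (hS : apSums S = Set.univ) :
    apSums T = Set.univ :=
  eq_univ_of_card_le (by rw [← Set.ncard_univ, ← hS]; exact ncard_apSums_le_of_le h)

theorem ncard_apSums_map_add (S : Multiset G) (g : G) :
    (apSums (S.map fun s => g + s)).ncard = (apSums S).ncard := by
  have key : ∀ (S : Multiset G) (g : G),
      (apSums S).ncard ≤ (apSums (S.map fun s => g + s)).ncard := by
    intro S g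
    obtain ⟨c, hc⟩ := exists_translate_apSums S g
    exact Set.ncard_le_ncard_of_injOn (fun x => c + x) hc (fun a _ b _ hab => by simpa using hab)
  refine le_antisymm ?_ (key S g)
  have := key (S.map fun s => g + s) (-g)
  simpa using this

/-- Pigeonhole: two sets with more than `|G|` elements in total have full sumset. -/
theorem exists_add_eq_of_card_lt {A B : Set G} (h : Nat.card G < A.ncard + B.ncard) (x : G) :
    ∃ a ∈ A, ∃ b ∈ B, a + b = x := by
  have h1 : ((fun b => x - b) '' B).ncard = B.ncard :=
    Set.ncard_image_of_injective _ (fun a b hab => by simpa using hab)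
  have h2 : (A ∩ (fun b => x - b) '' B).Nonempty := by
    by_contra hne
    rw [Set.not_nonempty_iff_eq_empty] at hne
    have := Set.ncard_union_eq (Set.disjoint_iff_inter_eq_empty.2 hne)
    have h3 := Set.ncard_le_card (A ∪ (fun b => x - b) '' B)
    omega
  obtain ⟨a, ha, b, hb, rfl⟩ := h2
  exact ⟨_, ha, b, hb, by simp⟩

/-- Swapping two distinct terms with consecutive weights. -/
theorem two_le_ncard_apSums {S : Multiset G} {a b : G} (ha : a ∈ S) (hb : b ∈ S) (hab : a ≠ b) :
    2 ≤ (apSums S).ncard := by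
  classical
  have hle : a ::ₘ {b} ≤ S := by
    obtain ⟨T, rfl⟩ := Multiset.exists_cons_of_mem ha
    rw [Multiset.cons_le_cons_iff, Multiset.singleton_le]
    simpa [hab.symm] using hb
  refine le_trans ?_ (ncard_apSums_le_of_le hle)
  have h1 := add_top_mem_apSums a (zero_mem_apSums_singleton b)
  have h2 := add_bot_mem_apSums a (zero_mem_apSums_singleton b)
  simp only [Multiset.card_singleton, Multiset.sum_singleton, one_smul, zero_add] at h1 h2
  calc 2 = ({a, b} : Set G).ncard := (Set.ncard_pair hab).symm
    _ ≤ _ := Set.ncard_le_ncard (by rintro x (rfl | rfl) <;> assumption)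

end WeightedSums

/-! ### The subgroup of differences and short spanning subsequences -/

section DifferenceSubgroup

variable {G : Type*} [AddCommGroup G]

/-- The subgroup generated by the differences of the terms of `S`. -/
def spanDiff (S : Multiset G) : AddSubgroup G :=
  AddSubgroup.closure {d | ∃ x ∈ S, ∃ y ∈ S, d = x - y}

theorem spanDiff_le_iff {S : Multiset G} {H : AddSubgroup G} :
    spanDiff S ≤ H ↔ ∀ x ∈ S, ∀ y ∈ S, x - y ∈ H := by
  rw [spanDiff, AddSubgroup.closure_le]
  constructor
  · intro h x hx y hy
    exact h ⟨x, hx, y, hy, rfl⟩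
  · rintro h d ⟨x, hx, y, hy, rfl⟩
    exact h x hx y hy

theorem sub_mem_spanDiff {S : Multiset G} {x y : G} (hx : x ∈ S) (hy : y ∈ S) :
    x - y ∈ spanDiff S :=
  spanDiff_le_iff.1 le_rfl x hx y hy

theorem spanDiff_le_iff_of_mem {S : Multiset G} {H : AddSubgroup G} {c : G} (hc : c ∈ S) :
    spanDiff S ≤ H ↔ ∀ x ∈ S, x - c ∈ H := by
  rw [spanDiff_le_iff]
  refine ⟨fun h x hx => h x hx c hc, fun h x hx y hy => ?_⟩
  simpa using H.sub_mem (h x hx) (h y hy)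

theorem inCosetOfProperSubgroup_iff {S : Multiset G} :
    InCosetOfProperSubgroup S ↔ spanDiff S ≠ ⊤ := by
  constructor
  · rintro ⟨H, hH, x, hx⟩ h
    refine hH (top_le_iff.1 (h ▸ spanDiff_le_iff.2 fun s hs t ht => ?_))
    simpa using H.sub_mem (hx s hs) (hx t ht)
  · intro h
    refine ⟨spanDiff S, h, ?_⟩
    rcases S.empty_or_exists_mem with rfl | ⟨c, hc⟩
    · exact ⟨0, by simp⟩
    · exact ⟨c, fun s hs => sub_mem_spanDiff hs hc⟩

theorem spanDiff_mono {S T : Multiset G} (h : S ≤ T) : spanDiff S ≤ spanDiff T :=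
  spanDiff_le_iff.2 fun _ hx _ hy =>
    sub_mem_spanDiff (Multiset.mem_of_le h hx) (Multiset.mem_of_le h hy)

theorem spanDiff_eq_top_of_le {S T : Multiset G} (h : S ≤ T) (hS : spanDiff S = ⊤) :
    spanDiff T = ⊤ :=
  top_le_iff.1 (hS ▸ spanDiff_mono h)

theorem spanDiff_map {H : Type*} [AddCommGroup H] (φ : G →+ H) (S : Multiset G) :
    spanDiff (S.map φ) = (spanDiff S).map φ := by
  refine le_antisymm (spanDiff_le_iff.2 ?_) (AddSubgroup.map_le_iff_le_comap.2
    (spanDiff_le_iff.2 ?_))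
  · simp only [Multiset.mem_map]
    rintro _ ⟨x, hx, rfl⟩ _ ⟨y, hy, rfl⟩
    exact ⟨x - y, sub_mem_spanDiff hx hy, by simp⟩
  · intro x hx y hy
    simpa using sub_mem_spanDiff (Multiset.mem_map_of_mem φ hx) (Multiset.mem_map_of_mem φ hy)

theorem spanDiff_map_add (S : Multiset G) (g : G) :
    spanDiff (S.map fun s => g + s) = spanDiff S := by
  refine le_antisymm (spanDiff_le_iff.2 ?_) (spanDiff_le_iff.2 ?_)
  · simp only [Multiset.mem_map]
    rintro _ ⟨x, hx, rfl⟩ _ ⟨y, hy, rfl⟩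
    simpa using sub_mem_spanDiff hx hy
  · intro x hx y hy
    simpa using sub_mem_spanDiff (S := S.map fun s => g + s)
      (Multiset.mem_map_of_mem _ hx) (Multiset.mem_map_of_mem _ hy)

theorem spanDiff_singleton (c : G) : spanDiff {c} = ⊥ := by
  rw [← le_bot_iff, spanDiff_le_iff]
  simp

theorem spanDiff_zero : spanDiff (0 : Multiset G) = ⊥ := by
  rw [← le_bot_iff, spanDiff_le_iff]
  simp

theorem spanDiff_cons {S : Multiset G} {c : G} (hc : c ∈ S) (h : G) :
    spanDiff (h ::ₘ S) = spanDiff S ⊔ AddSubgroup.zmultiples (h - c) := by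
  refine le_antisymm ((spanDiff_le_iff_of_mem (Multiset.mem_cons_of_mem hc)).2 fun x hx => ?_)
    (sup_le (spanDiff_mono (Multiset.le_cons_self S h)) ?_)
  · rcases Multiset.mem_cons.1 hx with rfl | hx
    · exact AddSubgroup.mem_sup_right (AddSubgroup.mem_zmultiples _)
    · exact AddSubgroup.mem_sup_left (sub_mem_spanDiff hx hc)
  · rw [AddSubgroup.zmultiples_le]
    exact sub_mem_spanDiff (Multiset.mem_cons_self h S) (Multiset.mem_cons_of_mem hc)

theorem eq_replicate_of_spanDiff_eq_bot {S : Multiset G} (h : spanDiff S = ⊥) {c : G}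
    (hc : c ∈ S) : S = Multiset.replicate S.card c :=
  Multiset.eq_replicate_card.2 fun b hb => by
    have := sub_mem_spanDiff hb hc
    rw [h, AddSubgroup.mem_bot] at this
    exact sub_eq_zero.1 this

theorem spanDiff_replicate (n : ℕ) (c : G) : spanDiff (Multiset.replicate n c) = ⊥ := by
  rw [← le_bot_iff, spanDiff_le_iff]
  intro x hx y hy
  rw [Multiset.eq_of_mem_replicate hx, Multiset.eq_of_mem_replicate hy]
  simp

theorem exists_pair_ne_of_spanDiff_ne_bot {S : Multiset G} (h : spanDiff S ≠ ⊥) :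
    ∃ a b : G, ∃ R, a ≠ b ∧ S = a ::ₘ b ::ₘ R := by
  by_contra! hc
  refine h (le_bot_iff.1 (spanDiff_le_iff.2 fun x hx y hy => ?_))
  by_contra hxy
  have hne : x ≠ y := fun e => hxy (by simp [e])
  obtain ⟨T, rfl⟩ := Multiset.exists_cons_of_mem hx
  have hy' : y ∈ T := by simpa [hne.symm] using hy
  obtain ⟨R, rfl⟩ := Multiset.exists_cons_of_mem hy'
  exact hc x y R hne rfl

/-- After a translation, `S` comes from a sequence over the subgroup of its differences. -/
theorem exists_lift_spanDiff {S : Multiset G} {c : G} (hc : c ∈ S) :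
    ∃ S₀ : Multiset (spanDiff S), S₀.map (spanDiff S).subtype = S.map (fun s => -c + s) ∧
      spanDiff S₀ = ⊤ := by
  have hmem : ∀ x ∈ S.map (fun s => -c + s), x ∈ spanDiff S := by
    simp only [Multiset.mem_map]
    rintro _ ⟨x, hx, rfl⟩
    rw [neg_add_eq_sub]
    exact sub_mem_spanDiff hx hc
  have hmap : ((S.map (fun s => -c + s)).pmap (fun x hx => (⟨x, hx⟩ : spanDiff S)) hmem).map
      (spanDiff S).subtype = S.map (fun s => -c + s) := by
    rw [Multiset.map_pmap]
    simp [Multiset.pmap_eq_map]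
  refine ⟨_, hmap, ?_⟩
  apply AddSubgroup.map_injective (spanDiff S).subtype_injective
  rw [← spanDiff_map, hmap, spanDiff_map_add, ← AddMonoidHom.range_eq_map,
    AddSubgroup.range_subtype]

theorem exists_le_le_card_eq {α : Type*} {M S : Multiset α} (h : M ≤ S) {l : ℕ} (h1 : M.card ≤ l)
    (h2 : l ≤ S.card) : ∃ T, M ≤ T ∧ T ≤ S ∧ T.card = l := by
  obtain ⟨R, rfl⟩ := Multiset.le_iff_exists_add.1 h
  rw [Multiset.card_add] at h2
  have hpos : 0 < (Multiset.powersetCard (l - M.card) R).card := by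
    rw [Multiset.card_powersetCard]
    exact Nat.choose_pos (by omega)
  obtain ⟨Q, hQ⟩ := Multiset.card_pos_iff_exists_mem.1 hpos
  obtain ⟨hQR, hQc⟩ := Multiset.mem_powersetCard.1 hQ
  exact ⟨M + Q, Multiset.le_add_right M Q, by gcongr, by rw [Multiset.card_add]; omega⟩

variable [Finite G]

theorem two_mul_card_le_of_lt {H K : AddSubgroup G} (h : H < K) :
    2 * Nat.card H ≤ Nat.card K := by
  obtain ⟨d, hd⟩ := AddSubgroup.card_dvd_of_le h.le
  have hK : 0 < Nat.card K := Nat.card_pos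
  rw [hd, mul_comm]
  refine Nat.mul_le_mul_left _ ?_
  by_contra! hlt
  have : d = 1 := by
    rcases Nat.lt_or_ge 0 d with h0 | h0
    · omega
    · simp [Nat.le_zero.1 h0] at hd; omega
  subst this
  exact h.ne (AddSubgroup.eq_of_le_of_card_ge h.le (by omega))

/-- A sequence has a short subsequence with the same differences. -/
theorem exists_short_spanning (S : Multiset G) (hS : S ≠ 0) :
    ∃ M ≤ S, M ≠ 0 ∧ spanDiff M = spanDiff S ∧ 2 ^ M.card ≤ 2 * Nat.card (spanDiff S) := by
  induction S using Multiset.induction with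
  | empty => exact absurd rfl hS
  | cons a S ih =>
    rcases eq_or_ne S 0 with rfl | hS0
    · exact ⟨{a}, le_rfl, by simp, rfl, by
        have : 0 < Nat.card (spanDiff (a ::ₘ 0)) := Nat.card_pos
        simp only [Multiset.card_singleton]; omega⟩
    obtain ⟨M, hM, hM0, hspan, hcard⟩ := ih hS0
    obtain ⟨c, hc⟩ := Multiset.exists_mem_of_ne_zero hM0
    have e : spanDiff (a ::ₘ S) = spanDiff (a ::ₘ M) := by
      rw [spanDiff_cons hc, spanDiff_cons (Multiset.mem_of_le hM hc), hspan]
    by_cases hlt : spanDiff M = spanDiff (a ::ₘ M)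
    · refine ⟨M, hM.trans (Multiset.le_cons_self S a), hM0, by rw [e, hlt], ?_⟩
      rw [e, ← hlt, hspan]; exact hcard
    · refine ⟨a ::ₘ M, Multiset.cons_le_cons a hM, by simp, e.symm, ?_⟩
      -- A term that enlarges the subgroup at least doubles it, which pays for the doubling of `2 ^
      -- M.card`.
      have := two_mul_card_le_of_lt
        (lt_of_le_of_ne (spanDiff_mono (Multiset.le_cons_self M a)) hlt)
      rw [hspan] at this
      rw [Multiset.card_cons, pow_succ, e]
      omega

/-- The numerical hypothesis bounds the subsequence of `exists_short_spanning` by `l`; padding keeps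
it spanning. -/
theorem exists_spanning_card_eq {S : Multiset G} (hS : spanDiff S = ⊤) {l : ℕ} (hl : l ≤ S.card)
    (hl' : 2 * Nat.card G < 2 ^ (l + 1)) : ∃ T ≤ S, spanDiff T = ⊤ ∧ T.card = l := by
  rcases eq_or_ne S 0 with rfl | hS0
  · exact ⟨0, le_rfl, hS, by simpa [eq_comm] using hl⟩
  obtain ⟨M, hM, -, hspan, hcard⟩ := exists_short_spanning S hS0
  have : M.card < l + 1 := by
    rw [hS, AddSubgroup.card_top] at hcard
    exact (Nat.pow_lt_pow_iff_right (by norm_num)).1 (hcard.trans_lt hl')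
  obtain ⟨T, h1, h2, h3⟩ := exists_le_le_card_eq hM (Nat.lt_succ_iff.1 this) hl
  exact ⟨T, h2, spanDiff_eq_top_of_le h1 (hspan.trans hS), h3⟩

end DifferenceSubgroup

/-! ### Sets with small boundary in generating directions -/

section Boundary

variable {G : Type*} [AddCommGroup G]

/-- At most one point of `X` leaves `X` when `γ` is subtracted. -/
def HasSmallBoundary (X : Set G) (γ : G) : Prop :=
  ∀ x ∈ X, ∀ y ∈ X, x - γ ∉ X → y - γ ∉ X → x = y

variable [Finite G]

/-- Negatives cost nothing: in a finite group `-a` is a natural multiple of `a`. -/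
theorem add_mem_of_mem_closure {A Γ : Set G} (h : ∀ γ ∈ Γ, ∀ x ∈ A, x + γ ∈ A) {g : G}
    (hg : g ∈ AddSubgroup.closure Γ) : ∀ x ∈ A, x + g ∈ A := by
  induction hg using AddSubgroup.closure_induction with
  | mem γ hγ => exact h γ hγ
  | zero => simp
  | add a b _ _ iha ihb =>
    intro x hx
    rw [← add_assoc]
    exact ihb _ (iha x hx)
  | neg a _ ih =>
    have hn : ∀ n : ℕ, ∀ x ∈ A, x + n • a ∈ A := by
      intro n
      induction n with
      | zero => simp
      | succ n ihn =>
        intro x hx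
        rw [succ_nsmul, ← add_assoc]
        exact ih _ (ihn x hx)
    have : -a = (addOrderOf a - 1) • a := by
      have h1 : addOrderOf a - 1 + 1 = addOrderOf a := Nat.sub_add_cancel (addOrderOf_pos a)
      rw [neg_eq_iff_add_eq_zero, ← succ_nsmul', h1, addOrderOf_nsmul_eq_zero]
    rw [this]
    exact hn _

theorem add_mem_of_mem_zmultiples {A : Set G} {d : G} (h : ∀ x ∈ A, x + d ∈ A) {g : G}
    (hg : g ∈ AddSubgroup.zmultiples d) : ∀ x ∈ A, x + g ∈ A := by
  rw [AddSubgroup.zmultiples_eq_closure] at hg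
  exact add_mem_of_mem_closure (by simpa using h) hg

theorem eq_empty_or_univ_of_closed {A Γ : Set G} (hΓ : AddSubgroup.closure Γ = ⊤)
    (h : ∀ γ ∈ Γ, ∀ x ∈ A, x + γ ∈ A) : A = ∅ ∨ A = Set.univ := by
  rcases A.eq_empty_or_nonempty with hA | ⟨a, ha⟩
  · exact Or.inl hA
  · refine Or.inr (Set.eq_univ_of_forall fun x => ?_)
    have := add_mem_of_mem_closure h (g := x - a) (by rw [hΓ]; trivial) a ha
    simpa using this

/-- `X` and `X + γ` have the same size, hence so do `X \ (X + γ)` and `(X + γ) \ X`, and the latter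
is a translate of `X \ (X - γ)`. -/
theorem HasSmallBoundary.neg {X : Set G} {γ : G} (h : HasSmallBoundary X γ) :
    HasSmallBoundary X (-γ) := by
  classical
  have key : (X \ (fun x => x - γ) '' X).ncard ≤ 1 := by
    have h1 : (X \ (fun x => x + γ) '' X).ncard ≤ 1 := by
      rw [Set.ncard_le_one]
      rintro a ⟨ha, ha'⟩ b ⟨hb, hb'⟩
      exact h a ha b hb (fun h => ha' ⟨_, h, by simp⟩) (fun h => hb' ⟨_, h, by simp⟩)
    have e1 : ((fun x => x + γ) '' X).ncard = X.ncard :=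
      Set.ncard_image_of_injective _ (add_left_injective γ)
    have e2 : ((fun x => x + γ) '' (X \ (fun x => x - γ) '' X)) = ((fun x => x + γ) '' X) \ X := by
      rw [Set.image_sdiff (add_left_injective γ), Set.image_image]
      simp
    rw [← Set.ncard_image_of_injective _ (add_left_injective γ), e2]
    have h3 := Set.ncard_sdiff_add_ncard X ((fun x => x + γ) '' X)
    have h4 := Set.ncard_sdiff_add_ncard ((fun x => x + γ) '' X) X
    rw [Set.union_comm] at h4
    omega
  rw [Set.ncard_le_one] at key
  intro x hx y hy hx' hy'
  refine key x ⟨hx, ?_⟩ y ⟨hy, ?_⟩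
  · rintro ⟨z, hz, rfl⟩; exact hx' (by simpa using hz)
  · rintro ⟨z, hz, rfl⟩; exact hy' (by simpa using hz)

theorem HasSmallBoundary.compl {X : Set G} {γ : G} (h : HasSmallBoundary X γ) :
    HasSmallBoundary Xᶜ γ := by
  intro x hx y hy hx' hy'
  have := h.neg (x - γ) (by simpa using hx') (y - γ) (by simpa using hy') (by simpa using hx)
    (by simpa using hy)
  simpa using this

/-- If `x` left `X` under adding `γ`, so would `x + d`: two boundary points. -/
theorem eq_empty_or_univ_of_periodic {X Γ : Set G} (hΓ : AddSubgroup.closure Γ = ⊤)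
    (hX : ∀ γ ∈ Γ, HasSmallBoundary X γ) {d : G} (hd : d ≠ 0) (h : ∀ x ∈ X, x + d ∈ X) :
    X = ∅ ∨ X = Set.univ := by
  refine eq_empty_or_univ_of_closed hΓ fun γ hγ x hx => ?_
  by_contra hxγ
  have hxd : x + d + γ ∉ X := fun hmem => hxγ <| by
    have := add_mem_of_mem_zmultiples h (g := -d) (by simp) _ hmem
    rwa [show x + d + γ + -d = x + γ by abel] at this
  have := (hX γ hγ).neg x hx (x + d) (h x hx) (by simpa using hxγ) (by simpa using hxd)
  exact hd (by simpa using this)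

/-- The only point leaving `X` under subtraction of `d` is `a`, so every coset of `⟨d⟩` other than
`a + ⟨d⟩` lies in `X` or misses it. -/
theorem add_mem_of_sub_notMem_zmultiples {X : Set G} {d a x l : G} (hX : HasSmallBoundary X d)
    (ha : a ∈ X) (had : a - d ∉ X) (hx : x ∈ X) (hxa : x - a ∉ AddSubgroup.zmultiples d)
    (hl : l ∈ AddSubgroup.zmultiples d) : x + l ∈ X := by
  have h : ∀ x ∈ {x ∈ X | x - a ∉ AddSubgroup.zmultiples d},
      x + -d ∈ {x ∈ X | x - a ∉ AddSubgroup.zmultiples d} := by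
    rintro x ⟨hx, hxa⟩
    refine ⟨?_, fun hmem => hxa ?_⟩
    · by_contra hxd
      rw [← sub_eq_add_neg] at hxd
      exact hxa (by simp [hX x hx a ha hxd had])
    · have := add_mem hmem (AddSubgroup.mem_zmultiples d)
      rwa [show x + -d - a + d = x - a by abel] at this
  exact (add_mem_of_mem_zmultiples h (g := l) (by simpa using hl) x ⟨hx, hxa⟩).1

/-- The case of a translate of a partially filled coset that misses `X`. -/
theorem partial_coset_of_add_notMem {X : Set G} {d a γ : G} (hd : d ≠ 0)
    (hX : HasSmallBoundary X d) (hγ : HasSmallBoundary X γ) (ha : a ∈ X) (had : a - d ∉ X)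
    (hγd : γ ∉ AddSubgroup.zmultiples d) (haγ : a + γ ∉ X) :
    (∀ x ∈ X, x - a ∈ AddSubgroup.zmultiples d → x = a) ∧
      ∀ x ∈ X, x ≠ a → x + γ ∈ X ∧ x + γ ≠ a := by
  have h1 : ∀ x ∈ X, x - a ∈ AddSubgroup.zmultiples d → x = a := by
    intro x hx hxa
    -- If `x + γ` were in `X`, its whole coset of `⟨d⟩` would be, including `a + γ`. So both `x` and
    -- `a` leave `X` under adding `γ`.
    refine hγ.neg x hx a ha (fun hmem => haγ ?_) (by simpa using haγ)
    rw [sub_neg_eq_add] at hmem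
    have := add_mem_of_sub_notMem_zmultiples hX ha had hmem
      (fun h => hγd (by simpa [show x + γ - a - (x - a) = γ by abel] using sub_mem h hxa))
      (neg_mem hxa)
    rwa [show x + γ + -(x - a) = a + γ by abel] at this
  have h2 : ∀ x ∈ X, x ≠ a → x + γ ∈ X := by
    intro x hx hxa
    by_contra h
    exact hxa (hγ.neg x hx a ha (by simpa using h) (by simpa using haγ))
  refine ⟨h1, fun x hx hxa => ⟨h2 x hx hxa, fun h => ?_⟩⟩
  -- If `x + γ = a`, then `x + d` is in `X` too, its coset being full, and it moves to `a + d`, a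
  -- second point of `X` in `a + ⟨d⟩`.
  have hxL : x - a ∉ AddSubgroup.zmultiples d := fun h' => hxa (h1 x hx h')
  have h3 : x + d ∈ X :=
    add_mem_of_sub_notMem_zmultiples hX ha had hx hxL (AddSubgroup.mem_zmultiples d)
  have h4 : x + d ≠ a := fun h' => hγd <| by
    rw [show γ = d from add_left_cancel (h.trans h'.symm)]
    exact AddSubgroup.mem_zmultiples d
  have h5 := h1 _ (h2 _ h3 h4) (by
    rw [show x + d + γ - a = d by rw [← h]; abel]
    exact AddSubgroup.mem_zmultiples d)
  exact hd (by rw [← h, add_right_comm] at h5; simpa using h5)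

/-- `X \ {a}` is invariant under all of `Γ` and misses `a`, so it is empty. -/
theorem subsingleton_of_add_notMem {X Γ : Set G} (hΓ : AddSubgroup.closure Γ = ⊤)
    (hX : ∀ γ ∈ Γ, HasSmallBoundary X γ) {d a γ₀ : G} (hd : d ≠ 0) (hdX : HasSmallBoundary X d)
    (ha : a ∈ X) (had : a - d ∉ X) (hγ₀ : γ₀ ∈ Γ) (hγ₀d : γ₀ ∉ AddSubgroup.zmultiples d)
    (h : ∀ γ ∈ Γ, γ ∉ AddSubgroup.zmultiples d → a + γ ∉ X) : X.Subsingleton := by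
  have h1 := (partial_coset_of_add_notMem hd hdX (hX _ hγ₀) ha had hγ₀d (h _ hγ₀ hγ₀d)).1
  have hY : X \ {a} = ∅ ∨ X \ {a} = Set.univ := by
    refine eq_empty_or_univ_of_closed hΓ ?_
    rintro γ hγ x ⟨hx, hxa⟩
    by_cases hγd : γ ∈ AddSubgroup.zmultiples d
    · have hxL : x - a ∉ AddSubgroup.zmultiples d := fun h' => hxa (h1 x hx h')
      refine ⟨add_mem_of_sub_notMem_zmultiples hdX ha had hx hxL hγd, fun h' => hxL ?_⟩
      rw [Set.mem_singleton_iff] at h'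
      rw [← h', show x - (x + γ) = -γ by abel]
      exact neg_mem hγd
    · exact (partial_coset_of_add_notMem hd hdX (hX _ hγ) ha had hγd (h _ hγ hγd)).2 x hx hxa
  rcases hY with hY | hY
  · exact Set.subsingleton_singleton.anti (Set.sdiff_eq_empty.1 hY)
  · have : a ∈ X \ {a} := by rw [hY]; trivial
    exact absurd rfl this.2

/-- A set with small boundary in all directions of a generating set that contains two independent
directions is trivial up to one point. -/
theorem subsingleton_or_compl_of_smallBoundary {X Γ : Set G} (hΓ : AddSubgroup.closure Γ = ⊤)
    (hX : ∀ γ ∈ Γ, HasSmallBoundary X γ) {d γ₀ : G} (hd : d ≠ 0) (hdΓ : d ∈ Γ) (hγ₀ : γ₀ ∈ Γ)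
    (hγ₀d : γ₀ ∉ AddSubgroup.zmultiples d) : X.Subsingleton ∨ Xᶜ.Subsingleton := by
  have hdX := hX d hdΓ
  by_cases hper : ∀ x ∈ X, x - d ∈ X
  · rcases eq_empty_or_univ_of_periodic hΓ hX (neg_ne_zero.2 hd)
      (by simpa [sub_eq_add_neg] using hper) with rfl | rfl
    · exact Or.inl Set.subsingleton_empty
    · exact Or.inr (by simp)
  push Not at hper
  obtain ⟨a, ha, had⟩ := hper
  have hXc : ∀ γ ∈ Γ, HasSmallBoundary Xᶜ γ := fun γ hγ => (hX γ hγ).compl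
  have hd' : γ₀ ∉ AddSubgroup.zmultiples (-d) := by simpa using hγ₀d
  have hshift : ∀ γ, γ ∉ AddSubgroup.zmultiples d → a + γ ∈ X → a - d + γ ∉ Xᶜ := by
    intro γ hγ hmem
    have := add_mem_of_sub_notMem_zmultiples hdX ha had hmem (l := -d) (by simpa using hγ) (by simp)
    rw [show a + γ + -d = a - d + γ by abel] at this
    simpa using this
  by_cases hE : ∀ γ ∈ Γ, γ ∉ AddSubgroup.zmultiples d → a + γ ∉ X
  · exact Or.inl (subsingleton_of_add_notMem hΓ hX hd hdX ha had hγ₀ hγ₀d hE)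
  by_cases hF : ∀ γ ∈ Γ, γ ∉ AddSubgroup.zmultiples d → a + γ ∈ X
  -- The same argument for the complement, with `a - d` and `-d` in place of `a` and `d`.
  · exact Or.inr (subsingleton_of_add_notMem hΓ hXc (neg_ne_zero.2 hd) hdX.compl.neg
      (a := a - d) had (by simpa using ha) hγ₀ hd'
      fun γ hγ hγd => hshift γ (by simpa using hγd) (hF γ hγ (by simpa using hγd)))
  push Not at hE hF
  obtain ⟨γ, hγ, hγd, hmem⟩ := hE
  obtain ⟨δ, hδ, hδd, hnot⟩ := hF
  exfalso
  -- Mixed case: `a + γ` stays in `X` under `δ`, while `a + δ` stays in the complement under `γ`,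
  -- yet both arrive at `a + γ + δ`.
  have h1 := ((partial_coset_of_add_notMem hd hdX (hX δ hδ) ha had hδd hnot).2 (a + γ) hmem
    (fun h => hγd (by simp [show γ = 0 by simpa using h]))).1
  have h2 := ((partial_coset_of_add_notMem (neg_ne_zero.2 hd) hdX.compl.neg (hXc γ hγ)
    (a := a - d) had (by simpa using ha) (by simpa using hγd) (hshift γ hγd hmem)).2 (a + δ) hnot
    (fun h => hδd (by
      rw [show δ = -d by rw [sub_eq_add_neg] at h; exact add_left_cancel h]; simp))).1
  rw [add_right_comm] at h2
  exact h2 h1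

end Boundary

/-! ### One term outside a coset: counting sums coset by coset -/

section Cosets

/-- Every sequence not in a coset of a proper subgroup has at least `min {|G| - 1, |S|}` sums. -/
def HasLowerBound (G : Type*) [AddCommGroup G] : Prop :=
  ∀ S : Multiset G, spanDiff S = ⊤ → min (Nat.card G - 1) S.card ≤ (apSums S).ncard

/-- Every sequence of length at least `|G| + 1` that is not in a coset of a proper subgroup has a
subsequence of length `|G|` with all sums. -/
def HasFullSubsequence (G : Type*) [AddCommGroup G] : Prop :=
  ∀ S : Multiset G, spanDiff S = ⊤ → Nat.card G + 1 ≤ S.card →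
    ∃ T ≤ S, T.card = Nat.card G ∧ apSums T = Set.univ

variable {G : Type*} [AddCommGroup G] {K : AddSubgroup G}

/-- The part of `apSums (h ::ₘ S)` in the coset `j • h + K`. -/
def cosetPart (S : Multiset K) (h : G) (j : ℕ) : Set K :=
  {κ | j • h + (κ : G) ∈ apSums (h ::ₘ S.map K.subtype)}

theorem mem_cosetPart {A B : Multiset K} (h : G) {x y : K} (hx : x ∈ apSums A)
    (hy : y ∈ apSums B) : x + ((A.card + 1) • B.sum + y) ∈ cosetPart (A + B) h A.card := by
  have := add_mid_mem_apSums h (map_mem_apSums K.subtype hx) (map_mem_apSums K.subtype hy)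
  rw [← Multiset.map_add] at this
  change A.card • h + K.subtype (x + ((A.card + 1) • B.sum + y)) ∈
    apSums (h ::ₘ (A + B).map K.subtype)
  convert this using 1
  rw [map_add, map_add, map_nsmul, map_multiset_sum, Multiset.card_map]
  abel

theorem cosetPart_nonempty {S : Multiset K} (h : G) {j : ℕ} (hj : j ≤ S.card) :
    (cosetPart S h j).Nonempty := by
  obtain ⟨A, -, hA, rfl⟩ := exists_le_le_card_eq (Multiset.zero_le S) (Nat.zero_le j) hj
  obtain ⟨B, rfl⟩ := Multiset.le_iff_exists_add.1 hA
  exact ⟨_, mem_cosetPart h (apSums_nonempty A).some_mem (apSums_nonempty B).some_mem⟩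

/-- The class of `h` generates `G ⧸ K`, so its order is the index. -/
theorem index_dvd_of_zsmul_mem {h : G} (hh : K ⊔ AddSubgroup.zmultiples h = ⊤) {j : ℤ}
    (hj : j • h ∈ K) : (K.index : ℤ) ∣ j := by
  have htop : AddSubgroup.zmultiples (h : G ⧸ K) = ⊤ := by
    have := congrArg (AddSubgroup.map (QuotientAddGroup.mk' K)) hh
    rw [AddSubgroup.map_sup, AddMonoidHom.map_zmultiples,
      AddSubgroup.map_top_of_surjective _ (QuotientAddGroup.mk'_surjective K)] at this
    simpa using this
  have : addOrderOf (h : G ⧸ K) = K.index := by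
    rw [← Nat.card_zmultiples, htop, AddSubgroup.card_top, AddSubgroup.index]
  rw [← this, addOrderOf_dvd_iff_zsmul_eq_zero, ← QuotientAddGroup.mk_zsmul,
    QuotientAddGroup.eq_zero_iff]
  exact hj

theorem spanDiff_ne_bot_of_eq_top {S : Multiset G} (hS : spanDiff S = ⊤) (hG : 2 ≤ Nat.card G) :
    spanDiff S ≠ ⊥ := by
  intro hbot
  have : Nat.card (⊥ : AddSubgroup G) = Nat.card (⊤ : AddSubgroup G) := by rw [← hS, hbot]
  rw [AddSubgroup.card_bot, AddSubgroup.card_top] at this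
  omega

variable [Finite G]

/-- With `A` frozen on the weights below that of `h`, the arrangements of `B` above it contribute a
translate of `apSums B`. -/
theorem ncard_apSums_le_ncard_cosetPart (A B : Multiset K) (h : G) :
    (apSums B).ncard ≤ (cosetPart (A + B) h A.card).ncard := by
  obtain ⟨x, hx⟩ := apSums_nonempty A
  exact Set.ncard_le_ncard_of_injOn (fun y => x + ((A.card + 1) • B.sum + y))
    (fun y hy => mem_cosetPart h hx hy) (fun a _ b _ hab => by simpa using hab)

/-- By `hj` there is room for a full subsequence of length `|K|` above the weight `j` of `h`. -/
theorem cosetPart_eq_univ (hK : HasFullSubsequence K) {S : Multiset K} (hS : spanDiff S = ⊤)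
    (hm : Nat.card K + 1 ≤ S.card) (h : G) {j : ℕ} (hj : j + Nat.card K ≤ S.card) :
    cosetPart S h j = Set.univ := by
  obtain ⟨V, hV, hVc, hVX⟩ := hK S hS hm
  obtain ⟨R, rfl⟩ := Multiset.le_iff_exists_add.1 hV
  rw [Multiset.card_add] at hj
  obtain ⟨A, -, hA, rfl⟩ := exists_le_le_card_eq (Multiset.zero_le R) (Nat.zero_le j) (by omega)
  obtain ⟨B, rfl⟩ := Multiset.le_iff_exists_add.1 hA
  apply eq_univ_of_card_le
  have h1 := ncard_apSums_le_ncard_cosetPart A (V + B) h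
  have h2 := ncard_apSums_le_of_le (Multiset.le_add_right V B)
  rw [hVX, Set.ncard_univ] at h2
  rw [add_left_comm]
  omega

theorem two_le_ncard_cosetPart_one {S : Multiset K} (hS : spanDiff S ≠ ⊥) (h : G)
    (h3 : 3 ≤ S.card) : 2 ≤ (cosetPart S h 1).ncard := by
  obtain ⟨a, b, R, hab, rfl⟩ := exists_pair_ne_of_spanDiff_ne_bot hS
  obtain ⟨t, ht⟩ : ∃ t, t ∈ R :=
    Multiset.card_pos_iff_exists_mem.1 (by simp only [Multiset.card_cons] at h3; omega)
  obtain ⟨R, rfl⟩ := Multiset.exists_cons_of_mem ht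
  have e : a ::ₘ b ::ₘ t ::ₘ R = {t} + a ::ₘ b ::ₘ R := by
    rw [Multiset.singleton_add, Multiset.cons_swap b, Multiset.cons_swap a]
  rw [e]
  exact (two_le_ncard_apSums (S := a ::ₘ b ::ₘ R) (by simp) (by simp) hab).trans
    (ncard_apSums_le_ncard_cosetPart {t} (a ::ₘ b ::ₘ R) h)

/-- With `h` on the weight `1`, the two terms get `0` and `2`. The doubles of the terms differ
because their difference generates a group of order at least three. -/
theorem two_le_ncard_cosetPart_one_of_pair {S : Multiset K} (hS : spanDiff S = ⊤) (h : G)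
    (h2 : S.card = 2) (hk : 3 ≤ Nat.card K) : 2 ≤ (cosetPart S h 1).ncard := by
  have hne : spanDiff S ≠ ⊥ := spanDiff_ne_bot_of_eq_top hS (by omega)
  obtain ⟨a, b, R, hab, rfl⟩ := exists_pair_ne_of_spanDiff_ne_bot hne
  obtain rfl : R = 0 := by simpa using h2
  have e1 : a ::ₘ b ::ₘ 0 = {a} + {b} := rfl
  have e2 : a ::ₘ b ::ₘ 0 = {b} + {a} := by rw [e1, add_comm]
  have m1 := mem_cosetPart h (zero_mem_apSums_singleton a) (zero_mem_apSums_singleton b)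
  have m2 := mem_cosetPart h (zero_mem_apSums_singleton b) (zero_mem_apSums_singleton a)
  rw [← e1] at m1
  rw [← e2] at m2
  simp only [Multiset.card_singleton, Multiset.sum_singleton, zero_add, add_zero] at m1 m2
  have hne2 : (1 + 1) • b ≠ (1 + 1) • a := by
    intro hEq
    have ho : addOrderOf (a - b) ≤ 2 :=
      addOrderOf_le_of_nsmul_eq_zero (by norm_num) (by rw [nsmul_sub, sub_eq_zero]; exact hEq.symm)
    have htop : AddSubgroup.zmultiples (a - b) = ⊤ := by
      rw [← hS]
      have := spanDiff_cons (S := {b}) (Multiset.mem_singleton_self b) a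
      rw [spanDiff_singleton, bot_sup_eq] at this
      exact this.symm
    have : Nat.card (AddSubgroup.zmultiples (a - b)) = Nat.card K := by
      rw [htop, AddSubgroup.card_top]
    rw [Nat.card_zmultiples] at this
    omega
  calc 2 = ({(1 + 1) • b, (1 + 1) • a} : Set K).ncard := (Set.ncard_pair hne2).symm
    _ ≤ _ := Set.ncard_le_ncard (by rintro x (rfl | rfl) <;> assumption)

/-- Different weights of `h` below the index land in different cosets of `K`. -/
theorem sum_ncard_cosetPart_le {h : G} (hh : K ⊔ AddSubgroup.zmultiples h = ⊤) (S : Multiset K)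
    {r : ℕ} (hr : r ≤ K.index) :
    ∑ j ∈ Finset.range r, (cosetPart S h j).ncard ≤
      (apSums (h ::ₘ S.map K.subtype)).ncard := by
  classical
  have := Fintype.ofFinite G
  simp_rw [Set.ncard_eq_toFinset_card']
  rw [← Finset.card_sigma]
  refine Finset.card_le_card_of_injOn (fun p => p.1 • h + (p.2 : G)) ?_ ?_
  · rintro ⟨j, κ⟩ hp
    have := Set.mem_toFinset.1 (Finset.mem_sigma.1 (Finset.mem_coe.1 hp)).2
    exact Finset.mem_coe.2 (Set.mem_toFinset.2 this)
  · rintro ⟨i, κ⟩ hp ⟨j, μ⟩ hq hEq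
    have hi := (Finset.mem_sigma.1 (Finset.mem_coe.1 hp)).1
    have hj := (Finset.mem_sigma.1 (Finset.mem_coe.1 hq)).1
    simp only [Finset.mem_range] at hi hj hEq
    have h1 : ((i : ℤ) - j) • h = (μ : G) - κ := by
      rw [sub_smul, natCast_zsmul, natCast_zsmul, sub_eq_sub_iff_add_eq_add, hEq, add_comm]
    have h2 := index_dvd_of_zsmul_mem hh (j := (i : ℤ) - j) (by rw [h1]; exact (μ - κ).2)
    have h3 : (i : ℤ) - j = 0 := Int.eq_zero_of_abs_lt_dvd h2 (by rw [abs_lt]; omega)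
    obtain rfl : i = j := by omega
    simpa using hEq

theorem apSums_eq_univ_of_coset (hK : HasFullSubsequence K) {S : Multiset K}
    (hS : spanDiff S = ⊤) {h : G} (hh : K ⊔ AddSubgroup.zmultiples h = ⊤)
    (hm : Nat.card K + 1 ≤ S.card) (hq : Nat.card K + K.index ≤ S.card + 1) :
    apSums (h ::ₘ S.map K.subtype) = Set.univ := by
  apply eq_univ_of_card_le
  refine le_trans (le_of_eq ?_) (sum_ncard_cosetPart_le hh S le_rfl)
  have : ∀ j ∈ Finset.range K.index, (cosetPart S h j).ncard = Nat.card K := by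
    intro j hj
    rw [Finset.mem_range] at hj
    rw [cosetPart_eq_univ hK hS hm h (by omega), Set.ncard_univ]
  rw [Finset.sum_congr rfl this, Finset.sum_const, Finset.card_range, smul_eq_mul, mul_comm,
    K.card_mul_index]

/-- A long sequence in a subgroup together with one further term. -/
theorem le_ncard_apSums_of_coset_long (hK : HasFullSubsequence K) {S : Multiset K}
    (hS : spanDiff S = ⊤) {h : G} (hh : K ⊔ AddSubgroup.zmultiples h = ⊤)
    (hk : 2 ≤ Nat.card K) (hm : Nat.card K + 1 ≤ S.card) :
    min (Nat.card G) (S.card + 2) ≤ (apSums (h ::ₘ S.map K.subtype)).ncard := by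
  rcases le_or_gt (Nat.card K + K.index) (S.card + 1) with hq | hq
  · rw [apSums_eq_univ_of_coset hK hS hh hm hq, Set.ncard_univ]
    exact min_le_left _ _
  · refine le_trans (min_le_right _ _) (le_trans ?_
      (sum_ncard_cosetPart_le hh S (r := S.card - Nat.card K + 2) (by omega)))
    have : ∀ j ∈ Finset.range (S.card - Nat.card K + 1),
        (cosetPart S h j).ncard = Nat.card K := by
      intro j hj
      rw [Finset.mem_range] at hj
      rw [cosetPart_eq_univ hK hS hm h (by omega), Set.ncard_univ]
    rw [Finset.sum_range_succ, Finset.sum_congr rfl this, Finset.sum_const, Finset.card_range,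
      smul_eq_mul]
    have h1 : 1 ≤ (cosetPart S h (S.card - Nat.card K + 1)).ncard :=
      (Set.ncard_pos).2 (cosetPart_nonempty h (by omega))
    obtain ⟨r, hr⟩ := Nat.exists_eq_add_of_le hm
    have h2 : S.card - Nat.card K = r + 1 := by omega
    rw [h2] at h1 ⊢
    -- With `k = |K| ≥ 2` and `|S| = k + 1 + r` the count is `(r + 2) * k + 1 ≥ k + r + 3`.
    nlinarith

/-- A short sequence in a subgroup together with one further term. -/
theorem le_ncard_apSums_of_coset_short (hK : HasLowerBound K) {S : Multiset K}
    (hS : spanDiff S = ⊤) {h : G} (hh : K ⊔ AddSubgroup.zmultiples h = ⊤)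
    (hk : 2 ≤ Nat.card K) (hq : 2 ≤ K.index) (hm : S.card < Nat.card K) :
    S.card + 2 ≤ (apSums (h ::ₘ S.map K.subtype)).ncard := by
  have hne : spanDiff S ≠ ⊥ := spanDiff_ne_bot_of_eq_top hS hk
  have hc : 2 ≤ S.card := by
    obtain ⟨a, b, R, -, rfl⟩ := exists_pair_ne_of_spanDiff_ne_bot hne
    simp
  have h1 : 2 ≤ (cosetPart S h 1).ncard := by
    rcases Nat.eq_or_lt_of_le hc with h2 | h3
    · exact two_le_ncard_cosetPart_one_of_pair hS h h2.symm (by omega)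
    · exact two_le_ncard_cosetPart_one hne h h3
  have h0 := hK S hS
  have h0' := ncard_apSums_le_ncard_cosetPart 0 S h
  simp only [zero_add, Multiset.card_zero] at h0'
  have := sum_ncard_cosetPart_le hh S hq
  simp only [Finset.sum_range_succ, Finset.sum_range_zero] at this
  omega

/-- A sequence of length `|K|` in a subgroup `K` together with one further term. -/
theorem le_ncard_apSums_of_coset_eq (hK : HasLowerBound K) {S : Multiset K}
    (hS : spanDiff S = ⊤) {h : G} (hh : K ⊔ AddSubgroup.zmultiples h = ⊤)
    (hk : 2 ≤ Nat.card K) (hq : 2 ≤ K.index) (hm : S.card = Nat.card K) :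
    S.card + min (K.index - 1) 2 ≤ (apSums (h ::ₘ S.map K.subtype)).ncard := by
  have hne : spanDiff S ≠ ⊥ := spanDiff_ne_bot_of_eq_top hS hk
  have h0 := hK S hS
  have h0' := ncard_apSums_le_ncard_cosetPart 0 S h
  simp only [zero_add, Multiset.card_zero] at h0'
  have h1 : 1 ≤ (cosetPart S h 1).ncard :=
    (Set.ncard_pos).2 (cosetPart_nonempty h (by omega))
  have h01 : S.card + 1 ≤ (cosetPart S h 0).ncard + (cosetPart S h 1).ncard := by
    -- For `|K| = 2` two sums already fill `K`; otherwise `K` has at least `|K| - 1` sums and `h +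
    -- K` at least two.
    rcases Nat.eq_or_lt_of_le hk with h2 | h3
    · obtain ⟨a, b, R, hab, rfl⟩ := exists_pair_ne_of_spanDiff_ne_bot hne
      have := two_le_ncard_apSums (S := a ::ₘ b ::ₘ R) (by simp) (by simp) hab
      omega
    · have := two_le_ncard_cosetPart_one hne h (by omega)
      omega
  rcases Nat.eq_or_lt_of_le hq with hq2 | hq3
  · have := sum_ncard_cosetPart_le hh S hq
    simp only [Finset.sum_range_succ, Finset.sum_range_zero] at this
    omega
  · have h2 : 1 ≤ (cosetPart S h 2).ncard :=
      (Set.ncard_pos).2 (cosetPart_nonempty h (by omega))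
    have := sum_ncard_cosetPart_le hh S (r := 3) hq3
    simp only [Finset.sum_range_succ, Finset.sum_range_zero] at this
    omega

end Cosets

/-! ### Non-spanning remainders and exchanges on the top weights -/

section LowerBound

variable {G : Type*} [AddCommGroup G] [Finite G]

theorem two_le_card_of_ne_bot {K : AddSubgroup G} (h : K ≠ ⊥) : 2 ≤ Nat.card K :=
  Nat.succ_le_iff.2 ((AddSubgroup.one_lt_card_iff_ne_bot K).2 h)

theorem two_le_index_of_ne_top {K : AddSubgroup G} (h : K ≠ ⊤) : 2 ≤ K.index := by
  have h0 : K.index ≠ 0 := AddSubgroup.index_ne_zero_of_finite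
  have h1 : K.index ≠ 1 := fun h' => h (AddSubgroup.index_eq_one.1 h')
  omega

/-- Translation by `-c` moves `S` into `spanDiff S` and preserves the number of sums, so the coset
counts apply. -/
theorem exists_coset_model {S : Multiset G} {c h : G} (hc : c ∈ S)
    (htop : spanDiff (h ::ₘ S) = ⊤) :
    ∃ S₀ : Multiset (spanDiff S), S₀.card = S.card ∧ spanDiff S₀ = ⊤ ∧
      spanDiff S ⊔ AddSubgroup.zmultiples (-c + h) = ⊤ ∧
      (apSums ((-c + h) ::ₘ S₀.map (spanDiff S).subtype)).ncard = (apSums (h ::ₘ S)).ncard := by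
  obtain ⟨S₀, h1, h2⟩ := exists_lift_spanDiff hc
  refine ⟨S₀, ?_, h2, ?_, ?_⟩
  · simpa using congrArg Multiset.card h1
  · rw [neg_add_eq_sub, ← spanDiff_cons hc, htop]
  · rw [h1, ← ncard_apSums_map_add (h ::ₘ S) (-c), Multiset.map_cons]

theorem le_ncard_apSums_of_not_spanning
    (IH : ∀ K : AddSubgroup G, K ≠ ⊤ → HasLowerBound K ∧ HasFullSubsequence K)
    {S : Multiset G} {h : G} (hS : S ≠ 0) (htop : spanDiff (h ::ₘ S) = ⊤)
    (hK : spanDiff S ≠ ⊤) : min (Nat.card G) (S.card + 1) ≤ (apSums (h ::ₘ S)).ncard := by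
  obtain ⟨c, hc⟩ := Multiset.exists_mem_of_ne_zero hS
  obtain ⟨S₀, hcard, hspan, hsup, hn⟩ := exists_coset_model hc htop
  rw [← hn, ← hcard]
  have hq := two_le_index_of_ne_top hK
  by_cases hbot : spanDiff S = ⊥
  · have hidx : (spanDiff S).index = Nat.card G := by
      rw [← (spanDiff S).card_mul_index, hbot, AddSubgroup.card_bot, one_mul]
    refine le_trans ?_ (sum_ncard_cosetPart_le hsup S₀
      (r := min (Nat.card G) (S₀.card + 1)) (by rw [hidx]; exact min_le_left _ _))
    calc min (Nat.card G) (S₀.card + 1)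
        = ∑ j ∈ Finset.range (min (Nat.card G) (S₀.card + 1)), 1 := by simp
      _ ≤ _ := Finset.sum_le_sum fun j hj => (Set.ncard_pos).2 (cosetPart_nonempty _ (by
          rw [Finset.mem_range] at hj; omega))
  have hk := two_le_card_of_ne_bot hbot
  rcases lt_trichotomy S₀.card (Nat.card (spanDiff S)) with hm | hm | hm
  · have := le_ncard_apSums_of_coset_short (IH _ hK).1 hspan hsup hk hq hm
    omega
  · have := le_ncard_apSums_of_coset_eq (IH _ hK).1 hspan hsup hk hq hm
    omega
  · have := le_ncard_apSums_of_coset_long (IH _ hK).2 hspan hsup hk hm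
    omega

/-- The case excluded by `hor`, length `|K|` and index two, is the one where the coset count
guarantees only `|S| + 1`. -/
theorem add_two_le_ncard_apSums_of_not_spanning
    (IH : ∀ K : AddSubgroup G, K ≠ ⊤ → HasLowerBound K ∧ HasFullSubsequence K)
    {S : Multiset G} {h : G} (htop : spanDiff (h ::ₘ S) = ⊤)
    (hK : spanDiff S ≠ ⊤) (hbot : spanDiff S ≠ ⊥)
    (hor : S.card ≠ Nat.card (spanDiff S) ∨ 3 ≤ (spanDiff S).index) :
    min (Nat.card G) (S.card + 2) ≤ (apSums (h ::ₘ S)).ncard := by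
  have hS : S ≠ 0 := by rintro rfl; exact hbot spanDiff_zero
  obtain ⟨c, hc⟩ := Multiset.exists_mem_of_ne_zero hS
  obtain ⟨S₀, hcard, hspan, hsup, hn⟩ := exists_coset_model hc htop
  rw [← hcard] at hor
  rw [← hn, ← hcard]
  have hq := two_le_index_of_ne_top hK
  have hk := two_le_card_of_ne_bot hbot
  rcases lt_trichotomy S₀.card (Nat.card (spanDiff S)) with hm | hm | hm
  · have := le_ncard_apSums_of_coset_short (IH _ hK).1 hspan hsup hk hq hm
    omega
  · have := le_ncard_apSums_of_coset_eq (IH _ hK).1 hspan hsup hk hq hm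
    omega
  · have := le_ncard_apSums_of_coset_long (IH _ hK).2 hspan hsup hk hm
    omega

theorem swap_top_mem_apSums {G : Type*} [AddCommGroup G] {R : Multiset G} {x : G} (g h : G) (hx : x ∈ apSums R) :
    x + R.card • h + (R.card + 1) • g ∈ apSums (g ::ₘ h ::ₘ R) := by
  simpa using add_top_mem_apSums g (add_top_mem_apSums h hx)

/-- Two terms outside of a subgroup of index two. -/
theorem le_ncard_apSums_of_index_two {K : AddSubgroup G} (hK : HasLowerBound K)
    (hidx : K.index = 2) {S : Multiset K} (hS : spanDiff S = ⊤) (hm : S.card = Nat.card K)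
    (hk : 3 ≤ Nat.card K) {g h : G} (hg : g ∉ K) (hh : h ∉ K) (hgh : g ≠ h) :
    Nat.card K + 2 ≤ (apSums (g ::ₘ h ::ₘ S.map K.subtype)).ncard := by
  have hsum : ∀ {a b : G}, a + b ∈ K ↔ (a ∈ K ↔ b ∈ K) :=
    AddSubgroup.add_mem_iff_of_index_two hidx
  have hgaddh : g + h ∈ K := hsum.2 (by tauto)
  have hgsubh : g - h ∈ K := by rw [sub_eq_add_neg, hsum, neg_mem_iff]; tauto
  set m := S.card with hmdef
  set u : G := m • h + (m + 1) • g with hu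
  -- Exchanging `g` and `h` on the two top weights shifts by `h - g ∈ K`; with at least `|K| - 1`
  -- sums of `S`, pigeonhole fills the coset `K + u`.
  have hfull : ∀ t : K, (t : G) + u ∈ apSums (g ::ₘ h ::ₘ S.map K.subtype) := by
    intro t
    have hne : (0 : K) ≠ ⟨h - g, by rw [← neg_sub]; exact neg_mem hgsubh⟩ := by
      intro h0
      have := congrArg Subtype.val h0
      exact hgh (sub_eq_zero.1 this.symm).symm
    have hcard : Nat.card K < (apSums S).ncard +
        ({0, ⟨h - g, by rw [← neg_sub]; exact neg_mem hgsubh⟩} : Set K).ncard := by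
      rw [Set.ncard_pair hne]
      have := hK S hS
      omega
    obtain ⟨x, hx, b, hb, rfl⟩ := exists_add_eq_of_card_lt hcard t
    have hx' := map_mem_apSums K.subtype hx
    rcases hb with rfl | rfl
    · have := swap_top_mem_apSums g h hx'
      simpa [hu, add_assoc] using this
    · have := swap_top_mem_apSums h g hx'
      rw [Multiset.cons_swap] at this
      convert this using 1
      simp only [Multiset.card_map, ← hmdef, hu, AddSubgroup.coe_add, AddSubgroup.coe_subtype,
        succ_nsmul]
      abel
  obtain ⟨a, b, R, hab, rfl⟩ :=
    exists_pair_ne_of_spanDiff_ne_bot (spanDiff_ne_bot_of_eq_top hS (by omega))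
  obtain ⟨t, ht⟩ : ∃ t, t ∈ R :=
    Multiset.card_pos_iff_exists_mem.1 (by
      have h4 := hmdef
      simp only [Multiset.card_cons] at h4
      omega)
  obtain ⟨R, rfl⟩ := Multiset.exists_cons_of_mem ht
  set Q := a ::ₘ b ::ₘ R with hQ
  have hSQ : a ::ₘ b ::ₘ t ::ₘ R = t ::ₘ Q := by
    rw [Multiset.cons_swap b, Multiset.cons_swap a]
  have hQ2 : 2 ≤ (apSums Q).ncard := two_le_ncard_apSums (by simp [hQ]) (by simp [hQ]) hab
  have hmQ : m = Q.card + 1 := by rw [hmdef, hSQ]; simp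
  -- Placing `t` between `h` and `g` lowers the weight of `h` by one, so these sums fall into the
  -- other coset, `K`.
  set v : G := Q.card • h + (Q.card + 1) • (t : G) + (Q.card + 2) • g with hv
  have hzero : ∀ x ∈ apSums Q, (x : G) + v ∈
      apSums (g ::ₘ h ::ₘ (a ::ₘ b ::ₘ t ::ₘ R).map K.subtype) := by
    intro x hx
    have := add_top_mem_apSums g (add_top_mem_apSums (t : G)
      (add_top_mem_apSums h (map_mem_apSums K.subtype hx)))
    rw [hSQ, Multiset.map_cons, Multiset.cons_swap h]
    have e : (x : G) + v = K.subtype x + (Q.map K.subtype).card • h +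
        (h ::ₘ Q.map K.subtype).card • (t : G) +
        ((t : G) ::ₘ h ::ₘ Q.map K.subtype).card • g := by
      simp only [hv, Multiset.card_cons, Multiset.card_map, AddSubgroup.coe_subtype]
      abel
    rw [e]
    exact this
  have hvK : v ∈ K := by
    have : v = Q.card • (g + h) + (Q.card + 1) • (t : G) + (g + g) := by
      rw [hv, nsmul_add, add_nsmul g, two_nsmul]; abel
    rw [this]
    exact add_mem (add_mem (nsmul_mem hgaddh _) (nsmul_mem t.2 _)) (hsum.2 Iff.rfl)
  have huK : u ∉ K := by
    have : u = m • (g + h) + g := by rw [hu, nsmul_add, succ_nsmul]; abel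
    rw [this, hsum]
    have := nsmul_mem hgaddh m
    tauto
  have hdisj : Disjoint ((fun t : K => (t : G) + u) '' Set.univ)
      ((fun x : K => (x : G) + v) '' apSums Q) := by
    rw [Set.disjoint_left]
    rintro _ ⟨t, -, rfl⟩ ⟨x, -, hx⟩
    refine huK ?_
    have : u = (x : G) + v - t := by rw [show (x : G) + v = t + u from hx]; abel
    rw [this]
    exact sub_mem (add_mem x.2 hvK) t.2
  have hinj : ∀ w : G, Function.Injective (fun t : K => (t : G) + w) :=
    fun w => (add_left_injective w).comp Subtype.val_injective
  calc Nat.card K + 2 ≤ ((fun t : K => (t : G) + u) '' Set.univ).ncard +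
        ((fun x : K => (x : G) + v) '' apSums Q).ncard := by
        rw [Set.ncard_image_of_injective _ (hinj u), Set.ncard_image_of_injective _ (hinj v),
          Set.ncard_univ]
        omega
    _ = _ := (Set.ncard_union_eq hdisj).symm
    _ ≤ _ := Set.ncard_le_ncard (by
        rintro _ (⟨t, -, rfl⟩ | ⟨x, hx, rfl⟩)
        · exact hfull t
        · exact hzero x hx)

/-- Exchanging two terms with the largest weights. -/
theorem hasSmallBoundary_of_ncard_le {R : Multiset G} {g h : G}
    (hle : (apSums (g ::ₘ h ::ₘ R)).ncard ≤ (apSums R).ncard + 1) :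
    HasSmallBoundary (apSums (g ::ₘ h ::ₘ R)) (g - h) := by
  set X := apSums (g ::ₘ h ::ₘ R) with hX
  set f : G → G := fun x => x + R.card • h + (R.card + 1) • g with hf
  have hfinj : Function.Injective f := fun a b hab => by simpa [hf] using hab
  have hsub : f '' apSums R ⊆ X := by
    rintro _ ⟨x, hx, rfl⟩
    exact swap_top_mem_apSums g h hx
  have hshift : ∀ y ∈ f '' apSums R, y - (g - h) ∈ X := by
    rintro _ ⟨x, hx, rfl⟩
    have := swap_top_mem_apSums h g hx
    rw [Multiset.cons_swap] at this
    convert this using 1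
    simp only [hf, succ_nsmul]
    abel
  have hone : (X \ f '' apSums R).ncard ≤ 1 := by
    rw [Set.ncard_sdiff hsub, Set.ncard_image_of_injective _ hfinj]
    omega
  rw [Set.ncard_le_one] at hone
  intro x hx y hy hx' hy'
  exact hone x ⟨hx, fun h => hx' (hshift x h)⟩ y ⟨hy, fun h => hy' (hshift y h)⟩

/-- Moving one term from the largest weight to the smallest. -/
theorem add_mem_apSums_of_ncard_le {R : Multiset G} {g : G}
    (hle : (apSums (g ::ₘ R)).ncard ≤ (apSums R).ncard) {x : G} (hx : x ∈ apSums (g ::ₘ R)) :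
    x + ((g ::ₘ R).sum - (g ::ₘ R).card • g) ∈ apSums (g ::ₘ R) := by
  have hEq : (fun x => x + R.card • g) '' apSums R = apSums (g ::ₘ R) := by
    refine Set.eq_of_subset_of_ncard_le ?_ ?_
    · rintro _ ⟨y, hy, rfl⟩
      exact add_top_mem_apSums g hy
    · rwa [Set.ncard_image_of_injective _ (add_left_injective _)]
  rw [← hEq] at hx
  obtain ⟨y, hy, rfl⟩ := hx
  convert add_bot_mem_apSums g hy using 1
  simp only [Multiset.sum_cons, Multiset.card_cons, succ_nsmul]
  abel

theorem mem_apSums_triple {G : Type*} [AddCommGroup G] (a b c : G) :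
    b + (a + a) ∈ apSums (a ::ₘ b ::ₘ {c}) ∧ a + (b + b) ∈ apSums (a ::ₘ b ::ₘ {c}) ∧
      c + (a + a) ∈ apSums (a ::ₘ b ::ₘ {c}) ∧ c + (b + b) ∈ apSums (a ::ₘ b ::ₘ {c}) := by
  have mem : ∀ p q r : G, q + (p + p) ∈ apSums (p ::ₘ q ::ₘ {r}) := by
    intro p q r
    have := swap_top_mem_apSums p q (zero_mem_apSums_singleton r)
    simpa [two_nsmul] using this
  have p1 : a ::ₘ b ::ₘ {c} = b ::ₘ a ::ₘ {c} := Multiset.cons_swap _ _ _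
  have p2 : a ::ₘ b ::ₘ {c} = a ::ₘ c ::ₘ {b} := congrArg _ (Multiset.cons_swap b c 0)
  have p3 : b ::ₘ a ::ₘ {c} = b ::ₘ c ::ₘ {a} := congrArg _ (Multiset.cons_swap a c 0)
  refine ⟨mem a b c, ?_, ?_, ?_⟩
  · rw [p1]; exact mem b a c
  · rw [p2]; exact mem a c b
  · rw [p1, p3]; exact mem b c a

/-- The four sums of `mem_apSums_triple` collapse to two only if the terms form a coset of a
subgroup of order three. -/
theorem three_le_ncard_apSums_triple {a b c : G} (hab : a ≠ b) (hac : a ≠ c) (hbc : b ≠ c)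
    (h3 : ¬ (c + a = b + b ∧ c + b = a + a)) : 3 ≤ (apSums (a ::ₘ b ::ₘ {c})).ncard := by
  obtain ⟨m1, m2, m3, m4⟩ := mem_apSums_triple a b c
  have d12 : b + (a + a) ≠ a + (b + b) := by
    intro h
    rw [add_left_comm b a, add_right_inj, add_right_inj] at h
    exact hab h
  have card3 : ∀ x y z : G, x ≠ y → x ≠ z → y ≠ z → x ∈ apSums (a ::ₘ b ::ₘ {c}) →
      y ∈ apSums (a ::ₘ b ::ₘ {c}) → z ∈ apSums (a ::ₘ b ::ₘ {c}) →
      3 ≤ (apSums (a ::ₘ b ::ₘ {c})).ncard := by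
    intro x y z hxy hxz hyz hx hy hz
    rw [← Set.ncard_eq_three.2 ⟨x, y, z, hxy, hxz, hyz, rfl⟩]
    exact Set.ncard_le_ncard (by rintro w (rfl | rfl | rfl) <;> assumption)
  by_cases h : c + (a + a) = a + (b + b)
  · refine card3 _ _ _ d12 ?_ ?_ m1 m2 m4
    · intro h'
      refine h3 ⟨?_, ?_⟩
      · rw [add_left_comm, add_right_inj] at h; exact h
      · rw [add_left_comm c b, add_right_inj] at h'; exact h'.symm
    · intro h'; exact hac (by simpa using h')
  · exact card3 _ _ _ d12 (by intro h'; exact hbc (by simpa using h')) (Ne.symm h) m1 m2 m3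

end LowerBound

/-! ### The induction on the order of the group -/

section Induction

variable {G : Type*} [AddCommGroup G] [Finite G]

theorem zmultiples_eq_top_of_spanDiff_cons {G : Type*} [AddCommGroup G] {R : Multiset G} {c g : G} (hc : c ∈ R)
    (hR : spanDiff R = ⊥) (h : spanDiff (g ::ₘ R) = ⊤) : AddSubgroup.zmultiples (g - c) = ⊤ := by
  rwa [spanDiff_cons hc, hR, bot_sup_eq] at h

/-- The induction step for two terms whose removal leaves a coset of a subgroup of index two. -/
theorem le_ncard_apSums_of_spanDiff_index_two {R : Multiset G} {g h : G}
    (hK : HasLowerBound (spanDiff R)) (hidx : (spanDiff R).index = 2)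
    (hm : R.card = Nat.card (spanDiff R)) (hk : 3 ≤ Nat.card (spanDiff R))
    (hg : spanDiff (g ::ₘ R) = ⊤) (hh : spanDiff (h ::ₘ R) = ⊤) (hgh : g ≠ h) :
    R.card + 2 ≤ (apSums (g ::ₘ h ::ₘ R)).ncard := by
  have hne : spanDiff R ≠ ⊤ := fun h => by rw [h, AddSubgroup.index_top] at hidx; omega
  obtain ⟨c, hc⟩ : ∃ c, c ∈ R := Multiset.card_pos_iff_exists_mem.1 (by omega)
  obtain ⟨S₀, h1, h2⟩ := exists_lift_spanDiff hc
  have hcard : S₀.card = R.card := by simpa using congrArg Multiset.card h1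
  have hnot : ∀ g, spanDiff (g ::ₘ R) = ⊤ → -c + g ∉ spanDiff R := by
    intro g hg hmem
    rw [spanDiff_cons hc, ← neg_add_eq_sub,
      sup_eq_left.2 (AddSubgroup.zmultiples_le.2 hmem)] at hg
    exact hne hg
  have := le_ncard_apSums_of_index_two hK hidx h2 (hcard.trans hm) hk (hnot g hg) (hnot h hh)
    (fun h => hgh (by simpa using h))
  rw [h1, ← Multiset.map_cons (fun s => -c + s), ← Multiset.map_cons (fun s => -c + s),
    ncard_apSums_map_add] at this
  omega

theorem card_le_ncard_apSums
    (IH : ∀ K : AddSubgroup G, K ≠ ⊤ → HasLowerBound K ∧ HasFullSubsequence K) (n : ℕ) :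
    ∀ S : Multiset G, S.card = n → spanDiff S = ⊤ → n < Nat.card G → n ≤ (apSums S).ncard := by
  induction n using Nat.strong_induction_on with
  | _ n ih =>
  intro S hSc hS hn
  by_contra! hlt
  have hnb := spanDiff_ne_bot_of_eq_top hS (by omega)
  have htb : (⊤ : AddSubgroup G) ≠ ⊥ := hS ▸ hnb
  have hnempty : apSums S ≠ ∅ := (apSums_nonempty S).ne_empty
  have hnuniv : apSums S ≠ Set.univ := by
    intro h
    rw [h, Set.ncard_univ] at hlt
    omega
  have hrem : ∀ g R, S = g ::ₘ R → spanDiff R = ⊤ := by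
    rintro g R rfl
    by_contra hR
    have hR0 : R ≠ 0 := by
      rintro rfl
      exact hnb (spanDiff_singleton g)
    have := le_ncard_apSums_of_not_spanning IH hR0 hS hR
    rw [Multiset.card_cons] at hSc
    omega
  have hle : ∀ g R, S = g ::ₘ R → (apSums S).ncard ≤ (apSums R).ncard := by
    intro g R hgR
    have h1 : R.card + 1 = n := by rw [← hSc, hgR, Multiset.card_cons]
    have := ih R.card (by omega) R rfl (hrem g R hgR) (by omega)
    omega
  have hbd : ∀ g h R, S = g ::ₘ h ::ₘ R → spanDiff R = ⊤ →
      HasSmallBoundary (apSums S) (g - h) := by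
    rintro g h R rfl hR
    simp only [Multiset.card_cons] at hSc
    have := ih R.card (by omega) R rfl hR (by omega)
    exact hasSmallBoundary_of_ncard_le (by omega)
  -- Otherwise `S.sum - n • g` is a nonzero period, which small boundary in generating directions
  -- excludes.
  have htors : ∀ Γ : Set G, AddSubgroup.closure Γ = ⊤ →
      (∀ γ ∈ Γ, HasSmallBoundary (apSums S) γ) → ∀ g ∈ S, n • g = S.sum := by
    intro Γ hΓ hΓX g hg
    obtain ⟨R, hgR⟩ := Multiset.exists_cons_of_mem hg
    by_contra hne
    have hper : ∀ x ∈ apSums S, x + (S.sum - n • g) ∈ apSums S := by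
      intro x hx
      have h1 := hle g R hgR
      rw [← hSc]
      rw [hgR] at h1 hx ⊢
      exact add_mem_apSums_of_ncard_le h1 hx
    rcases eq_empty_or_univ_of_periodic hΓ hΓX (sub_ne_zero.2 (Ne.symm hne)) hper with h | h
    · exact hnempty h
    · exact hnuniv h
  have hgen : ∀ Γ : Set G, AddSubgroup.closure Γ = ⊤ →
      (∀ γ ∈ Γ, HasSmallBoundary (apSums S) γ) → ∀ g ∈ S, ∀ h ∈ S,
      AddSubgroup.zmultiples (g - h) ≠ ⊤ := by
    intro Γ hΓ hΓX g hg h hh htop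
    have h1 : n • (g - h) = 0 := by
      rw [nsmul_sub, htors Γ hΓ hΓX g hg, htors Γ hΓ hΓX h hh, sub_self]
    have h2 := addOrderOf_dvd_of_nsmul_eq_zero h1
    rw [addOrderOf_eq_card_of_zmultiples_eq_top htop] at h2
    have := Nat.le_of_dvd (by omega) h2
    omega
  have hgood : ∀ g h R, g ≠ h → S = g ::ₘ h ::ₘ R → spanDiff R = ⊤ := by
    intro g h R hgh hSR
    by_contra hR
    have hh : spanDiff (h ::ₘ R) = ⊤ := hrem g _ hSR
    have hg : spanDiff (g ::ₘ R) = ⊤ := hrem h _ (by rw [hSR, Multiset.cons_swap])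
    have hcard : R.card + 2 = n := by rw [← hSc, hSR]; simp
    have hmono : (apSums (h ::ₘ R)).ncard ≤ (apSums S).ncard := by
      rw [hSR]; exact ncard_apSums_le_of_le (Multiset.le_cons_self _ _)
    obtain ⟨c, hc⟩ : ∃ c, c ∈ R := by
      rcases R.empty_or_exists_mem with rfl | h
      · exact absurd ((spanDiff_singleton h).symm.trans hh).symm htb
      · exact h
    by_cases hbot : spanDiff R = ⊥
    · have zg := zmultiples_eq_top_of_spanDiff_cons hc hbot hg
      have zh := zmultiples_eq_top_of_spanDiff_cons hc hbot hh
      have hne : ∀ x, AddSubgroup.zmultiples (x - c) = ⊤ → x ≠ c := by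
        rintro x hx rfl
        rw [sub_self, AddSubgroup.zmultiples_zero_eq_bot] at hx
        exact htb hx.symm
      obtain ⟨R', rfl⟩ := Multiset.exists_cons_of_mem hc
      -- A constant remainder: if it is one term, the triple has three sums. Otherwise `g` is
      -- exchanged with one copy of `c`, another copy keeps the rest spanning, and the direction `g
      -- - c` generates `G`.
      rcases R'.empty_or_exists_mem with rfl | ⟨c', hc'⟩
      · have h3 := three_le_ncard_apSums_triple hgh (hne g zg) (hne h zh) (by
          rintro ⟨e1, e2⟩
          have : 3 • (g - c) = 0 := by
            have e3 : g - c = (h - c) + (h - c) := by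
              rw [eq_sub_of_add_eq' e1]; abel
            have e4 : h - c = (g - c) + (g - c) := by
              rw [eq_sub_of_add_eq' e2]; abel
            have e5 : g - c = (g - c) + (g - c) + ((g - c) + (g - c)) := by
              rw [← e4]; exact e3
            have : (g - c) + (g - c) + ((g - c) + (g - c)) - (g - c) = 0 := by
              rw [← e5, sub_self]
            rw [← this]; abel
          have h2 := addOrderOf_dvd_of_nsmul_eq_zero this
          rw [addOrderOf_eq_card_of_zmultiples_eq_top zg] at h2
          have := Nat.le_of_dvd (by omega) h2
          simp at hcard
          omega)
        rw [hSR] at hlt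
        simp only [Multiset.card_cons, Multiset.card_zero] at hcard
        change 3 ≤ (apSums (g ::ₘ h ::ₘ c ::ₘ 0)).ncard at h3
        omega
      · have hb' : spanDiff R' = ⊥ :=
          le_bot_iff.1 (hbot ▸ spanDiff_mono (Multiset.le_cons_self R' c))
        have hcc : c' = c := by
          have := sub_mem_spanDiff (Multiset.mem_cons_of_mem hc') hc
          rw [hbot, AddSubgroup.mem_bot] at this
          exact sub_eq_zero.1 this
        subst hcc
        have e : S = g ::ₘ c' ::ₘ h ::ₘ R' := by rw [hSR, Multiset.cons_swap h]
        have hsp : spanDiff (h ::ₘ R') = ⊤ := by rw [spanDiff_cons hc', hb', zh, bot_sup_eq]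
        have hb := hbd _ _ _ e hsp
        refine hgen {g - c'} (by rw [← AddSubgroup.zmultiples_eq_closure, zg]) (by simpa using hb)
          g (by rw [e]; simp) c' (by rw [e]; simp) zg
    -- Here `h ::ₘ R` alone has `n` sums, unless `|R|` is the order of a subgroup of index two; then
    -- both `g` and `h` are needed.
    · by_cases hor : R.card ≠ Nat.card (spanDiff R) ∨ 3 ≤ (spanDiff R).index
      · have := add_two_le_ncard_apSums_of_not_spanning IH hh hR hbot hor
        omega
      · push Not at hor
        have hq := two_le_index_of_ne_top hR
        have hidx : (spanDiff R).index = 2 := by omega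
        have hN := (spanDiff R).card_mul_index
        rw [hidx] at hN
        have := le_ncard_apSums_of_spanDiff_index_two (IH _ hR).1 hidx hor.1 (by omega) hg hh hgh
        rw [← hSR] at this
        omega
  obtain ⟨a, b, R, hab, hSR⟩ := exists_pair_ne_of_spanDiff_ne_bot hnb
  have hR := hgood a b R hab hSR
  have ha : a ∈ S := by rw [hSR]; simp
  have hb : b ∈ S := by rw [hSR]; simp
  have hΓ : AddSubgroup.closure {d | ∃ x ∈ S, ∃ y ∈ S, d = x - y} = ⊤ := hS
  have hΓX : ∀ γ ∈ {d | ∃ x ∈ S, ∃ y ∈ S, d = x - y}, HasSmallBoundary (apSums S) γ := by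
    rintro γ ⟨x, hx, y, hy, rfl⟩
    rcases eq_or_ne x y with rfl | hxy
    · intro z hz _ _ hz' _
      exact absurd hz (by simpa using hz')
    · obtain ⟨T, hT⟩ := Multiset.exists_cons_of_mem hx
      have hyT : y ∈ T := by rw [hT] at hy; simpa [hxy.symm] using hy
      obtain ⟨Q, rfl⟩ := Multiset.exists_cons_of_mem hyT
      exact hbd x y Q hT (hgood x y Q hxy hT)
  have hztop := hgen _ hΓ hΓX a ha b hb
  obtain ⟨γ, hγ, hγd⟩ : ∃ γ ∈ {d | ∃ x ∈ S, ∃ y ∈ S, d = x - y},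
      γ ∉ AddSubgroup.zmultiples (a - b) := by
    by_contra! hall
    exact hztop (top_le_iff.1 (hΓ ▸ (AddSubgroup.closure_le _).2 hall))
  have hcardX := hle a _ hSR
  rcases subsingleton_or_compl_of_smallBoundary hΓ hΓX (sub_ne_zero.2 hab)
    ⟨a, ha, b, hb, rfl⟩ hγ hγd with hsub | hsub
  · have h1 : (apSums S).ncard ≤ 1 := Set.ncard_le_one_iff_subsingleton.2 hsub
    have h2 := two_le_ncard_apSums ha hb hab
    omega
  · have h1 : (apSums S)ᶜ.ncard ≤ 1 := Set.ncard_le_one_iff_subsingleton.2 hsub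
    have h2 := Set.ncard_add_ncard_compl (apSums S)
    omega

theorem two_mul_lt_two_pow {n : ℕ} (h : 3 ≤ n) : 2 * n < 2 ^ n := by
  induction n, h using Nat.le_induction with
  | base => norm_num
  | succ n hn ih => rw [pow_succ]; omega

/-- Long sequences reduce to a spanning subsequence of length `|G| - 1`, available once `2 * |G| < 2
^ |G|`. -/
theorem hasLowerBound_of_subgroups
    (IH : ∀ K : AddSubgroup G, K ≠ ⊤ → HasLowerBound K ∧ HasFullSubsequence K) :
    HasLowerBound G := by
  intro S hS
  rcases lt_or_ge S.card (Nat.card G) with hlt | hge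
  · exact (min_le_right _ _).trans (card_le_ncard_apSums IH _ S rfl hS hlt)
  · refine (min_le_left _ _).trans ?_
    rcases lt_or_ge (Nat.card G) 3 with h3 | h3
    · have : 0 < (apSums S).ncard := (Set.ncard_pos).2 (apSums_nonempty S)
      omega
    · obtain ⟨T, hTS, hT, hTc⟩ := exists_spanning_card_eq hS (l := Nat.card G - 1) (by omega)
        (by rw [Nat.sub_add_cancel (by omega)]; exact two_mul_lt_two_pow h3)
      have := card_le_ncard_apSums IH _ T hTc hT (by omega)
      exact this.trans (ncard_apSums_le_of_le hTS)

/-- The top weight for `g` adds `R.card • g = -g`, the weight `0` adds `R.sum`; these differ exactly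
when `S.sum ≠ 0`. If `R` does not span, the coset count already suffices. -/
theorem apSums_eq_univ_of_sum_ne_zero
    (IH : ∀ K : AddSubgroup G, K ≠ ⊤ → HasLowerBound K ∧ HasFullSubsequence K)
    (hG : HasLowerBound G) {S : Multiset G} (hS : spanDiff S = ⊤) (hc : S.card = Nat.card G)
    (h0 : S.sum ≠ 0) : apSums S = Set.univ := by
  have hne : S ≠ 0 := by rintro rfl; simp at h0
  obtain ⟨g, hg⟩ := Multiset.exists_mem_of_ne_zero hne
  obtain ⟨R, rfl⟩ := Multiset.exists_cons_of_mem hg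
  rw [Multiset.card_cons] at hc
  by_cases hR : spanDiff R = ⊤
  · have hne2 : R.card • g ≠ R.sum := by
      intro h
      rw [Multiset.sum_cons, ← h, ← succ_nsmul', hc, card_nsmul_eq_zero'] at h0
      exact h0 rfl
    refine Set.eq_univ_of_forall fun x => ?_
    have hcard : Nat.card G < (apSums R).ncard + ({R.card • g, R.sum} : Set G).ncard := by
      rw [Set.ncard_pair hne2]
      have := hG R hR
      omega
    obtain ⟨y, hy, b, rfl | rfl, rfl⟩ := exists_add_eq_of_card_lt hcard x
    · exact add_top_mem_apSums g hy
    · exact add_bot_mem_apSums g hy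
  · have hR0 : R ≠ 0 := by
      rintro rfl
      have : Subsingleton G := (Nat.card_eq_one_iff_unique.1 (by simpa using hc.symm)).1
      exact h0 (Subsingleton.elim _ _)
    apply eq_univ_of_card_le
    have := le_ncard_apSums_of_not_spanning IH hR0 hS hR
    omega

/-- A spanning subsequence of length `|G|` that fails has sum zero; replacing a term by a different
spare one makes the sum nonzero. -/
theorem hasFullSubsequence_of_subgroups
    (IH : ∀ K : AddSubgroup G, K ≠ ⊤ → HasLowerBound K ∧ HasFullSubsequence K)
    (hG : HasLowerBound G) : HasFullSubsequence G := by
  intro S hS hc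
  have hpos : 0 < Nat.card G := Nat.card_pos
  have hpow : Nat.card G < 2 ^ Nat.card G := Nat.lt_two_pow_self
  obtain ⟨S₁, hS₁S, hS₁, hc₁⟩ := exists_spanning_card_eq hS hc (by
    rw [pow_succ, pow_succ]; omega)
  obtain ⟨T, hT₁, hT, hTc⟩ := exists_spanning_card_eq hS₁ (l := Nat.card G) (by omega) (by
    rw [pow_succ]; omega)
  by_cases hX : apSums T = Set.univ
  · exact ⟨T, hT₁.trans hS₁S, hTc, hX⟩
  have hsum : T.sum = 0 := by
    by_contra h
    exact hX (apSums_eq_univ_of_sum_ne_zero IH hG hT hTc h)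
  have hG2 : 2 ≤ Nat.card G := by
    by_contra! h
    refine hX (eq_univ_of_card_le ?_)
    have : 0 < (apSums T).ncard := (Set.ncard_pos).2 (apSums_nonempty T)
    omega
  obtain ⟨Q, rfl⟩ := Multiset.le_iff_exists_add.1 hT₁
  obtain ⟨x, rfl⟩ : ∃ x, Q = {x} := Multiset.card_eq_one.1 (by
    rw [Multiset.card_add] at hc₁; omega)
  obtain ⟨y, hy, hyx⟩ : ∃ y ∈ T, y ≠ x := by
    obtain ⟨a, b, R, hab, rfl⟩ :=
      exists_pair_ne_of_spanDiff_ne_bot (spanDiff_ne_bot_of_eq_top hT hG2)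
    by_cases h : a = x
    · exact ⟨b, by simp, fun h' => hab (h.trans h'.symm)⟩
    · exact ⟨a, by simp, h⟩
  obtain ⟨R, rfl⟩ := Multiset.exists_cons_of_mem hy
  rw [Multiset.card_cons] at hTc
  have hR : spanDiff R = ⊤ := by
    by_contra hR
    have := le_ncard_apSums_of_not_spanning IH
      (by rintro rfl; simp at hTc; omega) hT hR
    exact hX (eq_univ_of_card_le (by omega))
  refine ⟨x ::ₘ R, le_trans ?_ hS₁S, by rw [Multiset.card_cons, hTc],
    apSums_eq_univ_of_sum_ne_zero IH hG
      (spanDiff_eq_top_of_le (Multiset.le_cons_self R x) hR) (by rw [Multiset.card_cons, hTc]) ?_⟩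
  · rw [← Multiset.singleton_add, add_comm]
    gcongr
    exact Multiset.le_cons_self R y
  · rw [Multiset.sum_cons] at hsum ⊢
    intro h
    exact hyx (add_right_cancel (hsum.trans h.symm))

end Induction

universe u

theorem hasLowerBound_and_hasFullSubsequence_of_card (N : ℕ) :
    ∀ (G : Type u) [AddCommGroup G] [Finite G], Nat.card G = N →
      HasLowerBound G ∧ HasFullSubsequence G := by
  induction N using Nat.strong_induction_on with
  | _ N ih =>
  intro G _ _ hN
  have IH : ∀ K : AddSubgroup G, K ≠ ⊤ → HasLowerBound K ∧ HasFullSubsequence K := by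
    intro K hK
    refine ih (Nat.card K) ?_ K rfl
    have := two_mul_card_le_of_lt (lt_top_iff_ne_top.2 hK)
    rw [AddSubgroup.card_top, hN] at this
    have : 0 < Nat.card K := Nat.card_pos
    omega
  exact ⟨hasLowerBound_of_subgroups IH,
    hasFullSubsequence_of_subgroups IH (hasLowerBound_of_subgroups IH)⟩

theorem hasLowerBound (G : Type u) [AddCommGroup G] [Finite G] : HasLowerBound G :=
  (hasLowerBound_and_hasFullSubsequence_of_card _ G rfl).1

theorem hasFullSubsequence (G : Type u) [AddCommGroup G] [Finite G] : HasFullSubsequence G :=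
  (hasLowerBound_and_hasFullSubsequence_of_card _ G rfl).2

/-! ### Configurations of length `|G|` that have all sums -/

section Extremal

variable {G : Type*} [AddCommGroup G]

theorem add_add_eq_of_triple {p q r : G} (h1 : q + r = p + p) (h2 : p + q = r + r) :
    p + r = q + q := by
  have : p + r - (q + q) = -(q + r - (p + p)) - (p + q - (r + r)) := by abel
  rw [h1, h2, sub_self, sub_self] at this
  rw [← sub_eq_zero, this]; simp

/-- For length `|G|` and sum zero this gives `j • (b - a) = 0` with `0 < j < |G|`, impossible when
`b - a` generates `G`. -/
theorem exists_sum_eq_of_two_values {a b : G} (hab : a ≠ b) (S : Multiset G)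
    (hS : ∀ x ∈ S, x = a ∨ x = b) :
    ∃ j ≤ S.card, (a ∈ S → j < S.card) ∧ (b ∈ S → 0 < j) ∧
      S.sum = S.card • a + j • (b - a) := by
  induction S using Multiset.induction with
  | empty => exact ⟨0, by simp⟩
  | cons x S ih =>
    obtain ⟨j, h1, h2, h3, h4⟩ := ih fun x hx => hS x (Multiset.mem_cons_of_mem hx)
    rcases hS x (Multiset.mem_cons_self x S) with rfl | rfl
    · refine ⟨j, by rw [Multiset.card_cons]; omega, fun _ => by rw [Multiset.card_cons]; omega,
        fun hb => h3 (by simpa [hab.symm] using hb), ?_⟩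
      rw [Multiset.sum_cons, h4, Multiset.card_cons, succ_nsmul]; abel
    · refine ⟨j + 1, by rw [Multiset.card_cons]; omega, fun ha => ?_, fun _ => by omega, ?_⟩
      · have := h2 (by simpa [hab] using ha)
        rw [Multiset.card_cons]; omega
      · rw [Multiset.sum_cons, h4, Multiset.card_cons, succ_nsmul, succ_nsmul]; abel

variable [Finite G]

theorem four_le_ncard_apSums_triple {a b c : G} (hab : a ≠ b) (hac : a ≠ c) (hbc : b ≠ c)
    (h2 : a + a ≠ b + b) (ha : b + c ≠ a + a) (hb : a + c ≠ b + b) :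
    4 ≤ (apSums (a ::ₘ b ::ₘ {c})).ncard := by
  classical
  obtain ⟨m1, m2, m3, m4⟩ := mem_apSums_triple a b c
  have hcard : (({b + (a + a), a + (b + b), c + (a + a), c + (b + b)} : Finset G) : Set G).ncard
      = 4 := by
    rw [Set.ncard_coe_finset, Finset.card_insert_of_notMem, Finset.card_insert_of_notMem,
      Finset.card_insert_of_notMem, Finset.card_singleton]
    · simpa using h2
    · simp only [Finset.mem_insert, Finset.mem_singleton, not_or]
      refine ⟨fun h => hb ?_, fun h => hac (by simpa using h)⟩
      rw [add_left_comm c a, add_right_inj] at h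
      exact (add_comm a c).trans h.symm
    · simp only [Finset.mem_insert, Finset.mem_singleton, not_or]
      refine ⟨fun h => hab ?_, fun h => hbc (by simpa using h), fun h => ha ?_⟩
      · rw [add_left_comm b a, add_right_inj, add_right_inj] at h
        exact h
      · rw [add_left_comm c b, add_right_inj] at h
        exact (add_comm b c).trans h.symm
  rw [← hcard]
  refine Set.ncard_le_ncard ?_
  intro x hx
  simp only [Finset.coe_insert, Finset.coe_singleton, Set.mem_insert_iff,
    Set.mem_singleton_iff] at hx
  rcases hx with rfl | rfl | rfl | rfl <;> assumption

/-- Three distinct terms that are neither in a coset of a group of order three nor have a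
difference of order two. -/
theorem apSums_eq_univ_of_triple {a b c : G} {U : Multiset G} (hab : a ≠ b) (hac : a ≠ c)
    (hbc : b ≠ c) (h2ab : a + a ≠ b + b) (h2ac : a + a ≠ c + c) (h2bc : b + b ≠ c + c)
    (h3 : ¬ (b + c = a + a ∧ a + c = b + b)) (hU : spanDiff U = ⊤)
    (hc : U.card + 3 = Nat.card G) : apSums (a ::ₘ b ::ₘ c ::ₘ U) = Set.univ := by
  -- Two of the three midpoint relations imply the third, so at most one holds; relabelling makes
  -- its midpoint the last term.
  have h4 : 4 ≤ (apSums (a ::ₘ b ::ₘ {c})).ncard := by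
    by_cases ha : b + c = a + a
    · have hb : a + c ≠ b + b := fun hb => h3 ⟨ha, hb⟩
      have hc' : a + b ≠ c + c := fun hc' => hb (add_add_eq_of_triple ha hc')
      have e : a ::ₘ b ::ₘ {c} = b ::ₘ c ::ₘ {a} := by
        change a ::ₘ b ::ₘ c ::ₘ 0 = b ::ₘ c ::ₘ a ::ₘ 0
        rw [Multiset.cons_swap a b, Multiset.cons_swap a c]
      rw [e]
      exact four_le_ncard_apSums_triple hbc hab.symm hac.symm h2bc (by rwa [add_comm])
        (by rwa [add_comm])
    · by_cases hb : a + c = b + b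
      · have hc' : a + b ≠ c + c := fun hc' => ha (by
          rw [add_comm] at hc'
          exact add_add_eq_of_triple hb hc')
        have e : a ::ₘ b ::ₘ {c} = a ::ₘ c ::ₘ {b} := congrArg _ (Multiset.cons_swap b c 0)
        rw [e]
        exact four_le_ncard_apSums_triple hac hab hbc.symm h2ac (by rwa [add_comm]) hc'
      · exact four_le_ncard_apSums_triple hab hac hbc h2ab ha hb
  refine Set.eq_univ_of_forall fun x => ?_
  -- Four sums on the weights `0, 1, 2` against at least `|G| - 3` sums of `U` above them.
  have hcard : Nat.card G < (apSums (a ::ₘ b ::ₘ {c})).ncard + (apSums U).ncard := by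
    have := hasLowerBound G U hU
    omega
  obtain ⟨y, hy, z, hz, hyz⟩ := exists_add_eq_of_card_lt hcard
    (x - (a ::ₘ b ::ₘ {c}).card • U.sum)
  have := add_mem_apSums hy hz
  rw [add_left_comm, hyz] at this
  simpa [Multiset.singleton_add] using this

theorem apSums_eq_univ_of_not_spanning {S : Multiset G} {h : G}
    (htop : spanDiff (h ::ₘ S) = ⊤) (hm : Nat.card (spanDiff S) + 1 ≤ S.card)
    (hq : Nat.card (spanDiff S) + (spanDiff S).index ≤ S.card + 1) :
    apSums (h ::ₘ S) = Set.univ := by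
  obtain ⟨c, hc⟩ : ∃ c, c ∈ S := Multiset.card_pos_iff_exists_mem.1 (by omega)
  obtain ⟨S₀, hcard, hspan, hsup, hn⟩ := exists_coset_model hc htop
  apply eq_univ_of_card_le
  rw [← hn, apSums_eq_univ_of_coset (hasFullSubsequence _) hspan hsup (by omega) (by omega),
    Set.ncard_univ]

/-- Two terms whose difference has order two. -/
theorem apSums_eq_univ_of_order_two {a b : G} {R : Multiset G} (hab : a ≠ b)
    (h2 : a + a = b + b) (hR : spanDiff R = ⊤) (hc : R.card + 2 = Nat.card G)
    (hN : 5 ≤ Nat.card G) : apSums (a ::ₘ b ::ₘ R) = Set.univ := by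
  set K := AddSubgroup.zmultiples (a - b) with hK
  have h2d : (2 : ℤ) • (a - b) = 0 := by
    rw [two_zsmul, show a - b + (a - b) = a + a - (b + b) by abel, h2, sub_self]
  have hcardK : Nat.card K = 2 := by
    rw [hK, Nat.card_zmultiples]
    exact addOrderOf_eq_prime (by exact_mod_cast h2d) (sub_ne_zero.2 hab)
  have hq := K.card_mul_index
  rw [hcardK, AddSubgroup.index] at hq
  have hspan : spanDiff (R.map (QuotientAddGroup.mk' K)) = ⊤ := by
    rw [spanDiff_map, hR,
      AddSubgroup.map_top_of_surjective _ (QuotientAddGroup.mk'_surjective K)]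
  -- Since `|G|` is even and at least five, `|G| - 2 ≥ |G| / 2 + 1`, so `R` has all sums modulo `K`.
  obtain ⟨T, hT, -, hTX⟩ := hasFullSubsequence (G ⧸ K) _ hspan (by
    rw [Multiset.card_map]; omega)
  have hX := apSums_eq_univ_of_le hT hTX
  refine Set.eq_univ_of_forall fun x => ?_
  have hx : QuotientAddGroup.mk' K (x - (R.card • b + (R.card + 1) • a)) ∈
      apSums (R.map (QuotientAddGroup.mk' K)) := by rw [hX]; trivial
  obtain ⟨y, hy, hyx⟩ := exists_of_mem_apSums_map _ hx
  rw [QuotientAddGroup.mk'_apply, QuotientAddGroup.mk'_apply, QuotientAddGroup.eq] at hyx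
  obtain ⟨i, hi⟩ := AddSubgroup.mem_zmultiples_iff.1 hyx
  -- The two lifts of a class modulo `K` are exchanged by swapping `a` and `b` on the top weights.
  rcases Int.even_or_odd' i with ⟨l, rfl | rfl⟩
  · have e : x = y + R.card • b + (R.card + 1) • a := by
      rw [mul_comm, mul_smul, h2d, smul_zero] at hi
      have : x = y + (R.card • b + (R.card + 1) • a) +
          (-y + (x - (R.card • b + (R.card + 1) • a))) := by abel
      rw [this, ← hi]; abel
    rw [e]
    exact swap_top_mem_apSums a b hy
  · have e : x = y + R.card • a + (R.card + 1) • b := by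
      rw [mul_comm, add_smul, mul_smul, h2d, smul_zero, zero_add, one_smul] at hi
      have h3 : a - b = b - a := by
        rw [sub_eq_sub_iff_add_eq_add, h2]
      have : x = y + (R.card • b + (R.card + 1) • a) +
          (-y + (x - (R.card • b + (R.card + 1) • a))) := by abel
      rw [this, ← hi, h3, succ_nsmul, succ_nsmul]; abel
    rw [e, Multiset.cons_swap]
    exact swap_top_mem_apSums b a hy

theorem add_eq_zero_of_card_eq_three {K : AddSubgroup G} (hK : Nat.card K = 3) {d e : G}
    (hd : d ∈ K) (he : e ∈ K) (hd0 : d ≠ 0) (he0 : e ≠ 0) (hde : d ≠ e) : d + e = 0 := by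
  classical
  by_contra hne
  have hsub : (({0, d, e, d + e} : Finset G) : Set G) ⊆ (K : Set G) := by
    intro x hx
    simp only [Finset.coe_insert, Finset.coe_singleton, Set.mem_insert_iff,
      Set.mem_singleton_iff] at hx
    rcases hx with rfl | rfl | rfl | rfl
    · exact K.zero_mem
    · exact hd
    · exact he
    · exact K.add_mem hd he
  have h1 := Set.ncard_le_ncard hsub
  have h2 : (K : Set G).ncard = 3 := hK
  rw [Set.ncard_coe_finset, h2, Finset.card_insert_of_notMem, Finset.card_insert_of_notMem,
    Finset.card_insert_of_notMem, Finset.card_singleton] at h1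
  · omega
  · simpa using hd0
  · simp [hde, he0]
  · simp [hd0.symm, he0.symm, Ne.symm hne]

end Extremal

/-! ### Classification of the exceptional sequences -/

section Classification

variable {G : Type*} [AddCommGroup G]

/-- Since `|G| • c = 0`, the zero sum determines `h` from `g` and `c`. -/
theorem eq_of_constant_remainder {g h c : G} {R : Multiset G} (hc : c ∈ R)
    (hR : spanDiff R = ⊥) (hg : spanDiff (g ::ₘ R) = ⊤) (hcard : R.card + 2 = Nat.card G)
    (hsum : (g ::ₘ h ::ₘ R).sum = 0) :
    addOrderOf (g - c) = Nat.card G ∧ g ::ₘ h ::ₘ R =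
      Multiset.replicate (Nat.card G - 2) c + {c + (g - c), c - (g - c)} := by
  refine ⟨addOrderOf_eq_card_of_zmultiples_eq_top (zmultiples_eq_top_of_spanDiff_cons hc hR hg), ?_⟩
  have hrep := eq_replicate_of_spanDiff_eq_bot hR hc
  have hh : h = c - (g - c) := by
    have h1 : (R.card + 2) • c = 0 := by rw [hcard, card_nsmul_eq_zero']
    have h2 : R.sum = R.card • c := by
      nth_rw 1 [hrep]
      rw [Multiset.sum_replicate]
    rw [Multiset.sum_cons, Multiset.sum_cons, h2] at hsum
    have : h - (c - (g - c)) = g + (h + R.card • c) - (R.card + 2) • c := by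
      rw [add_nsmul, two_nsmul]; abel
    rw [hsum, h1, sub_self] at this
    exact sub_eq_zero.1 this
  rw [← hcard, Nat.add_sub_cancel, ← hrep, ← hh, add_sub_cancel, add_comm]
  simp [Multiset.insert_eq_cons]

theorem mem_of_nodup_of_card_eq {α : Type*} [Finite α] {S : Multiset α} (hnd : S.Nodup)
    (hc : S.card = Nat.card α) (x : α) : x ∈ S := by
  classical
  have := Fintype.ofFinite α
  have hS : S.toFinset = Finset.univ := by
    rw [← Finset.card_eq_iff_eq_univ, Multiset.toFinset_card_of_nodup hnd, hc,
      Nat.card_eq_fintype_card]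
  rw [← Multiset.mem_toFinset, hS]
  exact Finset.mem_univ x

/-- Otherwise `x` has order four and `S` consists of its multiples, with sum `6 • x = 2 • x ≠ 0`. -/
theorem add_self_eq_zero_of_nodup [Finite G] {S : Multiset G} (hN : Nat.card G = 4) (hc : S.card = 4)
    (hnd : S.Nodup) (hsum : S.sum = 0) (x : G) : x + x = 0 := by
  by_contra hx
  have h4 : 4 • x = 0 := by rw [← hN, card_nsmul_eq_zero']
  have hx0 : x ≠ 0 := by rintro rfl; simp at hx
  have h3 : x + (x + x) ≠ 0 := by
    intro h
    have : 4 • x = x + (x + (x + x)) := by abel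
    rw [h4, h, add_zero] at this
    exact hx0 this.symm
  have hT : (0 ::ₘ x ::ₘ (x + x) ::ₘ {x + (x + x)} : Multiset G) ≤ S := by
    rw [Multiset.le_iff_subset]
    · intro y _
      exact mem_of_nodup_of_card_eq hnd (hc.trans hN.symm) y
    · simp only [Multiset.nodup_cons, Multiset.mem_cons, Multiset.mem_singleton, not_or,
        Multiset.nodup_singleton, and_true]
      refine ⟨⟨hx0.symm, Ne.symm hx, Ne.symm h3⟩, ⟨?_, ?_⟩, ?_⟩
      · intro h; exact hx0 (by simpa using h)
      · intro h; exact hx (by simpa using h)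
      · intro h; exact hx0 (by simpa using h)
  have hEq := Multiset.eq_of_le_of_card_le hT (by simp [hc])
  rw [← hEq] at hsum
  have : x + x = (0 ::ₘ x ::ₘ (x + x) ::ₘ {x + (x + x)} : Multiset G).sum - 4 • x := by
    simp only [Multiset.sum_cons, Multiset.sum_singleton]; abel
  rw [hsum, h4, sub_zero] at this
  exact hx this

/-- Two values are too few by `exists_sum_eq_of_two_values`. If three values form a coset of a
subgroup of order three, they do not span, so there is a fourth, and substituting it breaks the
relations. -/
theorem exists_triple {S : Multiset G} (hS : spanDiff S = ⊤) (hc : S.card = Nat.card G)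
    (hsum : S.sum = 0) (hN : 4 ≤ Nat.card G) :
    ∃ a b c U, S = a ::ₘ b ::ₘ c ::ₘ U ∧ a ≠ b ∧ a ≠ c ∧ b ≠ c ∧
      ¬ (b + c = a + a ∧ a + c = b + b) := by
  obtain ⟨a, b, R, hab, rfl⟩ :=
    exists_pair_ne_of_spanDiff_ne_bot (spanDiff_ne_bot_of_eq_top hS (by omega))
  have hle : ∀ H : AddSubgroup G, (∀ x ∈ R, x - a ∈ H) → b - a ∈ H → H = ⊤ := by
    intro H h1 h2
    refine top_le_iff.1 (hS ▸ (spanDiff_le_iff_of_mem (Multiset.mem_cons_self a _)).2 ?_)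
    intro x hx
    rcases Multiset.mem_cons.1 hx with rfl | hx
    · rw [sub_self]; exact H.zero_mem
    · rcases Multiset.mem_cons.1 hx with rfl | hx
      · exact h2
      · exact h1 x hx
  obtain ⟨t, htR, hta, htb⟩ : ∃ t ∈ R, t ≠ a ∧ t ≠ b := by
    by_contra! hno
    have hval : ∀ x ∈ a ::ₘ b ::ₘ R, x = a ∨ x = b := by
      intro x hx
      simp only [Multiset.mem_cons] at hx
      rcases hx with h | h | h
      · exact Or.inl h
      · exact Or.inr h
      · by_cases hxa : x = a
        · exact Or.inl hxa
        · exact Or.inr (hno x h hxa)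
    obtain ⟨j, -, h2, h3, h4⟩ := exists_sum_eq_of_two_values hab _ hval
    have h2 := h2 (by simp)
    have h3 := h3 (by simp)
    rw [hsum, hc, card_nsmul_eq_zero', zero_add] at h4
    have hz : AddSubgroup.zmultiples (b - a) = ⊤ := by
      refine hle _ (fun x hx => ?_) (AddSubgroup.mem_zmultiples _)
      rcases hval x (by simp [hx]) with rfl | rfl
      · rw [sub_self]; exact zero_mem _
      · exact AddSubgroup.mem_zmultiples _
    have h5 := addOrderOf_dvd_of_nsmul_eq_zero h4.symm
    rw [addOrderOf_eq_card_of_zmultiples_eq_top hz] at h5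
    have := Nat.le_of_dvd h3 h5
    omega
  obtain ⟨Q, rfl⟩ := Multiset.exists_cons_of_mem htR
  by_cases h3 : b + t = a + a ∧ a + t = b + b
  · obtain ⟨u, hu, hua, hub, hut⟩ : ∃ u ∈ Q, u ≠ a ∧ u ≠ b ∧ u ≠ t := by
      by_contra! hno
      have hz : AddSubgroup.zmultiples (b - a) = ⊤ := by
        have ht : t - a ∈ AddSubgroup.zmultiples (b - a) := by
          rw [show t - a = -(b - a) by rw [eq_sub_of_add_eq' h3.1]; abel]
          exact neg_mem (AddSubgroup.mem_zmultiples _)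
        refine hle _ (fun x hx => ?_) (AddSubgroup.mem_zmultiples _)
        rcases Multiset.mem_cons.1 hx with rfl | hx
        · exact ht
        by_cases hxa : x = a
        · rw [hxa, sub_self]; exact zero_mem _
        by_cases hxb : x = b
        · rw [hxb]; exact AddSubgroup.mem_zmultiples _
        rw [hno x hx hxa hxb]; exact ht
      have h5 : 3 • (b - a) = 0 := by
        have : 3 • (b - a) = (b + t - (a + a)) - (a + t - (b + b)) := by abel
        rw [this, h3.1, h3.2]; simp
      have h6 := addOrderOf_dvd_of_nsmul_eq_zero h5
      rw [addOrderOf_eq_card_of_zmultiples_eq_top hz] at h6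
      have := Nat.le_of_dvd (by norm_num) h6
      omega
    obtain ⟨P, rfl⟩ := Multiset.exists_cons_of_mem hu
    refine ⟨a, b, u, t ::ₘ P, by rw [Multiset.cons_swap t], hab, hua.symm, hub.symm, fun h => hut ?_⟩
    exact add_left_cancel (h.1.trans h3.1.symm)
  · exact ⟨a, b, t, Q, rfl, hab, hta.symm, htb.symm, h3⟩

/-- The sequences of length `|G|` that do not have all sums. -/
theorem classification_of_apSums_ne_univ [Finite G] {S : Multiset G} (hS : spanDiff S = ⊤)
    (hc : S.card = Nat.card G) (hX : apSums S ≠ Set.univ) :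
    S.sum = 0 ∧ 3 ≤ Nat.card G ∧ ((Nat.card G = 4 ∧ (∀ x : G, x + x = 0) ∧ S.Nodup) ∨
      ∃ c g : G, addOrderOf g = Nat.card G ∧
        S = Multiset.replicate (Nat.card G - 2) c + {c + g, c - g}) := by
  have IH : ∀ K : AddSubgroup G, K ≠ ⊤ → HasLowerBound K ∧ HasFullSubsequence K :=
    fun K _ => ⟨hasLowerBound K, hasFullSubsequence K⟩
  have hG2 : 2 ≤ Nat.card G := by
    by_contra! h
    refine hX (eq_univ_of_card_le ?_)
    have : 0 < (apSums S).ncard := (Set.ncard_pos).2 (apSums_nonempty S)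
    omega
  have hsum : S.sum = 0 := by
    by_contra h
    exact hX (apSums_eq_univ_of_sum_ne_zero IH (hasLowerBound G) hS hc h)
  have hnb := spanDiff_ne_bot_of_eq_top hS hG2
  have htb : (⊤ : AddSubgroup G) ≠ ⊥ := hS ▸ hnb
  have hrem : ∀ g R, S = g ::ₘ R → spanDiff R = ⊤ := by
    rintro g R rfl
    by_contra hR
    have hR0 : R ≠ 0 := by
      rintro rfl
      exact hnb (spanDiff_singleton g)
    have := le_ncard_apSums_of_not_spanning IH hR0 hS hR
    rw [Multiset.card_cons] at hc
    exact hX (eq_univ_of_card_le (by omega))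
  have hmono : ∀ T ≤ S, apSums T ≠ Set.univ := fun T hT h => hX (apSums_eq_univ_of_le hT h)
  have hnonempty : ∀ g h R, S = g ::ₘ h ::ₘ R → ∃ c, c ∈ R := by
    intro g h R hSR
    rcases R.empty_or_exists_mem with rfl | h'
    · exact absurd ((spanDiff_singleton h).symm.trans (hrem g _ hSR)).symm htb
    · exact h'
  have hconst : ∀ g h R, S = g ::ₘ h ::ₘ R → spanDiff R = ⊥ →
      ∃ c g : G, addOrderOf g = Nat.card G ∧
        S = Multiset.replicate (Nat.card G - 2) c + {c + g, c - g} := by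
    intro g h R hSR hR
    obtain ⟨c, hcR⟩ := hnonempty g h R hSR
    have hg := hrem h (g ::ₘ R) (by rw [hSR, Multiset.cons_swap])
    obtain ⟨h1, h2⟩ := eq_of_constant_remainder (h := h) hcR hR hg
      (by rw [← hc, hSR]; simp) (by rw [← hSR, hsum])
    exact ⟨c, g - c, h1, hSR.trans h2⟩
  have hG3 : 3 ≤ Nat.card G := by
    obtain ⟨a, b, R, -, hSR⟩ := exists_pair_ne_of_spanDiff_ne_bot hnb
    have := Multiset.card_pos_iff_exists_mem.2 (hnonempty a b R hSR)
    rw [← hc, hSR, Multiset.card_cons, Multiset.card_cons]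
    omega
  refine ⟨hsum, hG3, ?_⟩
  by_cases hN4 : Nat.card G = 4
  · by_cases hnd : S.Nodup
    · exact Or.inl ⟨hN4, add_self_eq_zero_of_nodup hN4 (hc.trans hN4) hnd hsum, hnd⟩
    · right
      rw [Multiset.nodup_iff_ne_cons_cons] at hnd
      push Not at hnd
      obtain ⟨c, T, hT⟩ := hnd
      obtain ⟨g, h, rfl⟩ := Multiset.card_eq_two.1 (show T.card = 2 by
        have := hc; rw [hN4, hT] at this; simpa using this)
      refine hconst g h (Multiset.replicate 2 c) ?_ (spanDiff_replicate 2 c)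
      rw [hT]
      change ({c, c} : Multiset G) + {g, h} = {g, h} + {c, c}
      exact add_comm _ _
  by_contra hex
  push Not at hex
  have hbot : ∀ g h R, S = g ::ₘ h ::ₘ R → spanDiff R ≠ ⊥ := by
    intro g h R hSR hR
    obtain ⟨c, g, h1, h2⟩ := hconst g h R hSR hR
    exact hex.2 c g h1 h2
  have hgood : ∀ g h R, g ≠ h → S = g ::ₘ h ::ₘ R → spanDiff R = ⊤ := by
    intro g h R _ hSR
    by_contra hR
    have hk := two_le_card_of_ne_bot (hbot g h R hSR)
    have hq := two_le_index_of_ne_top hR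
    have hkq := (spanDiff R).card_mul_index
    have hcard : R.card + 2 = Nat.card G := by rw [← hc, hSR]; simp
    -- Order `k` and index `q` are at least two and not both two, so `(k - 1) * (q - 1) ≥ 2`.
    have : Nat.card (spanDiff R) + (spanDiff R).index + 1 ≤ Nat.card G := by
      rw [← hkq] at hN4 ⊢
      generalize Nat.card (spanDiff R) = k at *
      generalize (spanDiff R).index = q at *
      obtain ⟨i, rfl⟩ := Nat.exists_eq_add_of_le hk
      obtain ⟨j, rfl⟩ := Nat.exists_eq_add_of_le hq
      have : ¬ (i = 0 ∧ j = 0) := by rintro ⟨rfl, rfl⟩; exact hN4 rfl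
      have : 0 < i + j := by omega
      nlinarith [Nat.zero_le (i * j)]
    refine hmono (h ::ₘ R) (by rw [hSR]; exact Multiset.le_cons_self _ _) ?_
    exact apSums_eq_univ_of_not_spanning (hrem g _ hSR) (by omega) (by omega)
  have hG5 : 5 ≤ Nat.card G := by
    by_contra! hlt
    have h3 : Nat.card G = 3 := by omega
    obtain ⟨a, b, R, hab, hSR⟩ := exists_pair_ne_of_spanDiff_ne_bot hnb
    obtain ⟨c, rfl⟩ := Multiset.card_eq_one.1 (show R.card = 1 by
      have := hc; rw [h3, hSR] at this; simpa using this)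
    exact htb ((hgood a b _ hab hSR).symm.trans (spanDiff_singleton c))
  have hord : ∀ a ∈ S, ∀ b ∈ S, a ≠ b → a + a ≠ b + b := by
    intro a ha b hb hab h2
    obtain ⟨T, hT⟩ := Multiset.exists_cons_of_mem ha
    have hbT : b ∈ T := by rw [hT] at hb; simpa [hab.symm] using hb
    obtain ⟨R, rfl⟩ := Multiset.exists_cons_of_mem hbT
    refine hX ?_
    rw [hT]
    exact apSums_eq_univ_of_order_two hab h2 (hgood a b R hab hT) (by rw [← hc, hT]; simp) hG5
  obtain ⟨a, b, c, U, hSU, hab, hac, hbc, h3⟩ := exists_triple hS hc hsum (by omega)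
  have ha : a ∈ S := by rw [hSU]; simp
  have hb : b ∈ S := by rw [hSU]; simp
  have hcS : c ∈ S := by rw [hSU]; simp
  have hUc : U.card + 3 = Nat.card G := by rw [← hc, hSU]; simp
  have hUS : ∀ x ∈ U, x ∈ S := by
    intro x hx
    rw [hSU]; simp [hx]
  by_cases hU : spanDiff U = ⊤
  · refine hX ?_
    rw [hSU]
    exact apSums_eq_univ_of_triple hab hac hbc (hord a ha b hb hab) (hord a ha c hcS hac)
      (hord b hb c hcS hbc) h3 hU hUc
  have sc : spanDiff (c ::ₘ U) = ⊤ := hgood a b _ hab hSU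
  have sa : spanDiff (a ::ₘ U) = ⊤ := hgood b c _ hbc (by
    rw [hSU, Multiset.cons_swap a b, Multiset.cons_swap a c])
  have sb : spanDiff (b ::ₘ U) = ⊤ := hgood a c _ hac (by rw [hSU, Multiset.cons_swap b c])
  obtain ⟨x, hx⟩ : ∃ x, x ∈ U := Multiset.card_pos_iff_exists_mem.1 (by omega)
  -- For constant `U`, one copy of its value replaces `c` in the triple, and `c` joins the other
  -- copies to make them span.
  by_cases hUb : spanDiff U = ⊥
  · have za := zmultiples_eq_top_of_spanDiff_cons hx hUb sa
    have zb := zmultiples_eq_top_of_spanDiff_cons hx hUb sb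
    have zc := zmultiples_eq_top_of_spanDiff_cons hx hUb sc
    have hne : ∀ y, AddSubgroup.zmultiples (y - x) = ⊤ → x ≠ y := by
      rintro y hy rfl
      rw [sub_self, AddSubgroup.zmultiples_zero_eq_bot] at hy
      exact htb hy.symm
    have hxS := hUS x hx
    obtain ⟨V, rfl⟩ := Multiset.exists_cons_of_mem hx
    rw [Multiset.card_cons] at hUc
    obtain ⟨y, hy⟩ : ∃ y, y ∈ V := Multiset.card_pos_iff_exists_mem.1 (by omega)
    have hyx : y = x := by
      have := sub_mem_spanDiff (Multiset.mem_cons_of_mem hy) hx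
      rw [hUb, AddSubgroup.mem_bot] at this
      exact sub_eq_zero.1 this
    subst hyx
    have hV : spanDiff V = ⊥ :=
      le_bot_iff.1 (hUb ▸ spanDiff_mono (Multiset.le_cons_self V y))
    have hcV : spanDiff (c ::ₘ V) = ⊤ := by rw [spanDiff_cons hy, hV, zc, bot_sup_eq]
    refine hX ?_
    have e : S = y ::ₘ a ::ₘ b ::ₘ c ::ₘ V := by
      rw [hSU, Multiset.cons_swap c y, Multiset.cons_swap b y, Multiset.cons_swap a y]
    rw [e]
    refine apSums_eq_univ_of_triple (hne a za) (hne b zb) hab (hord y hxS a ha (hne a za))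
      (hord y hxS b hb (hne b zb)) (hord a ha b hb hab) ?_ hcV
      (by rw [Multiset.card_cons]; omega)
    rintro ⟨h1, h2⟩
    have h5 : 3 • (a - y) = 0 := by
      have : 3 • (a - y) = (a + b - (y + y)) - (y + b - (a + a)) := by abel
      rw [this, h1, h2]; simp
    have h6 := addOrderOf_dvd_of_nsmul_eq_zero h5
    rw [addOrderOf_eq_card_of_zmultiples_eq_top za] at h6
    have := Nat.le_of_dvd (by norm_num) h6
    omega
  have hk := two_le_card_of_ne_bot hUb
  have hq := two_le_index_of_ne_top hU
  have hkq := (spanDiff U).card_mul_index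
  by_cases hfull : Nat.card (spanDiff U) + (spanDiff U).index + 2 ≤ Nat.card G
  · refine hmono (c ::ₘ U) ?_ (apSums_eq_univ_of_not_spanning sc (by omega) (by omega))
    rw [hSU]
    exact (Multiset.le_cons_self _ b).trans (Multiset.le_cons_self _ a)
  -- Failure of `hfull` means `(k - 1) * (q - 1) < 3` for the order `k` and index `q`.
  have hsmall : Nat.card (spanDiff U) = 2 ∨
      (Nat.card (spanDiff U) = 3 ∧ (spanDiff U).index = 2) := by
    rw [← hkq] at hfull
    generalize Nat.card (spanDiff U) = k at *
    generalize (spanDiff U).index = q at *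
    obtain ⟨i, rfl⟩ := Nat.exists_eq_add_of_le hk
    obtain ⟨j, rfl⟩ := Nat.exists_eq_add_of_le hq
    rcases i with _ | _ | i
    · exact Or.inl rfl
    · refine Or.inr ⟨rfl, ?_⟩
      by_contra hj
      exact hfull (by omega)
    · exfalso
      apply hfull
      nlinarith [Nat.zero_le (i * j)]
  rcases hsmall with h2 | ⟨hk3, hq2⟩
  · obtain ⟨u, v, Q, huv, hUQ⟩ := exists_pair_ne_of_spanDiff_ne_bot hUb
    have hu : u ∈ U := by rw [hUQ]; simp
    have hv : v ∈ U := by rw [hUQ]; simp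
    refine hord u (hUS u hu) v (hUS v hv) huv ?_
    have h5 : Nat.card (spanDiff U) • (⟨u - v, sub_mem_spanDiff hu hv⟩ : spanDiff U) = 0 :=
      card_nsmul_eq_zero'
    have h6 := congrArg Subtype.val h5
    rw [h2, two_nsmul] at h6
    have h7 : u - v + (u - v) = 0 := h6
    rw [← sub_eq_zero, ← h7]; abel
  -- Here `a, b, c` make up the other coset of a subgroup of order three, so they satisfy the
  -- relations excluded by `h3`.
  · have hnot : ∀ y, spanDiff (y ::ₘ U) = ⊤ → y - x ∉ spanDiff U := by
      intro y hy hmem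
      rw [spanDiff_cons hx, sup_eq_left.2 (AddSubgroup.zmultiples_le.2 hmem)] at hy
      exact hU hy
    have hdiff : ∀ y z, spanDiff (y ::ₘ U) = ⊤ → spanDiff (z ::ₘ U) = ⊤ →
        y - z ∈ spanDiff U := by
      intro y z hy hz
      have h1 := hnot y hy
      have h2 := hnot z hz
      rw [show y - z = (y - x) + -(z - x) by abel, AddSubgroup.add_mem_iff_of_index_two hq2,
        neg_mem_iff]
      tauto
    refine h3 ⟨?_, ?_⟩
    · have := add_eq_zero_of_card_eq_three hk3 (hdiff b a sb sa) (hdiff c a sc sa)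
        (sub_ne_zero.2 hab.symm) (sub_ne_zero.2 hac.symm) (fun h => hbc (by simpa using h))
      rw [← sub_eq_zero, ← this]; abel
    · have := add_eq_zero_of_card_eq_three hk3 (hdiff a b sa sb) (hdiff c b sc sb)
        (sub_ne_zero.2 hab) (sub_ne_zero.2 hbc.symm) (fun h => hac (by simpa using h))
      rw [← sub_eq_zero, ← this]; abel

end Classification

/-! ### All elements but one are sums of an exceptional sequence -/

section MissingElement

variable {G : Type*} [AddCommGroup G]

/-- The weights `0, 1, 2, 3` on `v, z, u, 0` give `z + 2 • u = z`. -/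
theorem mem_apSums_of_nodup [Finite G] {S : Multiset G} (hN : Nat.card G = 4) (hc : S.card = 4)
    (hnd : S.Nodup) (h2 : ∀ x : G, x + x = 0) (hsum : S.sum = 0) {z : G} (hz : z ≠ 0) :
    z ∈ apSums S := by
  have hall := mem_of_nodup_of_card_eq hnd (hc.trans hN.symm)
  obtain ⟨T, rfl⟩ := Multiset.exists_cons_of_mem (hall 0)
  have hzT : z ∈ T := by simpa [hz] using hall z
  obtain ⟨R, rfl⟩ := Multiset.exists_cons_of_mem hzT
  obtain ⟨u, v, rfl⟩ := Multiset.card_eq_two.1 (show R.card = 2 by simpa using hc)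
  have h := add_top_mem_apSums 0 (add_top_mem_apSums u
    (add_top_mem_apSums z (zero_mem_apSums_singleton v)))
  rw [Multiset.cons_swap u] at h
  simpa [two_nsmul, h2] using h

theorem zero_mem_apSums_replicate (n : ℕ) : (0 : G) ∈ apSums (Multiset.replicate n (0 : G)) := by
  induction n with
  | zero => exact zero_mem_apSums_zero
  | succ n ih =>
    rw [Multiset.replicate_succ]
    simpa using add_top_mem_apSums 0 ih

/-- The term `-g` gets the weight `0` and `g` the weight `j`. -/
theorem nsmul_mem_apSums_replicate (g : G) {n j : ℕ} (h0 : 0 < j) (hj : j < n) :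
    j • g ∈ apSums (Multiset.replicate (n - 2) 0 + {g, -g}) := by
  have h1 : (0 : G) ∈ apSums (-g ::ₘ Multiset.replicate (j - 1) 0) := by
    simpa using add_bot_mem_apSums (-g) (zero_mem_apSums_replicate (j - 1))
  have h2 := add_mid_mem_apSums g h1 (zero_mem_apSums_replicate (n - 1 - j))
  have e : g ::ₘ (-g ::ₘ Multiset.replicate (j - 1) 0 + Multiset.replicate (n - 1 - j) 0) =
      Multiset.replicate (n - 2) 0 + {g, -g} := by
    rw [Multiset.cons_add, ← Multiset.replicate_add, show j - 1 + (n - 1 - j) = n - 2 by omega,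
      add_comm]
    simp [Multiset.insert_eq_cons]
  rw [e] at h2
  simpa [Nat.sub_add_cancel h0] using h2

theorem sum_consecutiveIntegers_zero (n : ℕ) :
    (consecutiveIntegers 0 n).sum = (((n - 1) * n / 2 : ℕ) : ℤ) := by
  rw [mul_comm, ← Finset.sum_range_id]
  simp [consecutiveIntegers, Finset.sum]

theorem add_nsmul_mem_apSums {S : Multiset G} {c g : G} {n : ℕ} (hn : 2 ≤ n)
    (hS : S = Multiset.replicate (n - 2) c + {c + g, c - g}) {j : ℕ} (h0 : 0 < j) (hj : j < n) :
    ((n - 1) * n / 2) • c + j • g ∈ apSums S := by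
  have e : S = (Multiset.replicate (n - 2) 0 + {g, -g}).map fun s => c + s := by
    rw [hS]
    simp [sub_eq_add_neg]
  have hcard : S.card = n := by
    rw [hS]
    simp
    omega
  have := translate_mem_weightedSumset (W := consecutiveIntegers 0 n)
    (S := Multiset.replicate (n - 2) 0 + {g, -g}) (by simp; omega) c (x := j • g) (by
      have := nsmul_mem_apSums_replicate g h0 hj
      unfold apSums at this
      rwa [show (Multiset.replicate (n - 2) 0 + {g, -g} : Multiset G).card = n by simp; omega]
        at this)
  rw [← e, sum_consecutiveIntegers_zero, natCast_zsmul] at this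
  unfold apSums
  rwa [hcard]

end MissingElement

/-! ### Assembly of the three statements -/

theorem theorem1p1 {G : Type*} [AddCommGroup G] [Finite G] (S : Multiset G)
    (hS : ¬ InCosetOfProperSubgroup S) (W : Multiset ℤ)
    (hW : ∃ a : ℤ, W = consecutiveIntegers a S.card) :
    min (Nat.card G - 1) S.card ≤ (weightedSumset W S).ncard ∧
    (Nat.card G + 1 ≤ S.card →
      weightedSumset W S = Set.univ ∧
      ∃ S' : Multiset G, S' ≤ S ∧ S'.card = Nat.card G ∧
        weightedSumset (consecutiveIntegers 0 (Nat.card G)) S' = Set.univ) ∧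
    (S.card = Nat.card G → weightedSumset W S ≠ Set.univ →
      3 ≤ Nat.card G ∧
      ((Nonempty (G ≃+ ZMod 2 × ZMod 2) ∧
          {g : G | g ∈ S}.ncard = 4 ∧ S.card = 4 ∧ Nat.card G = 4 ∧
          weightedSumset W S = Set.univ \ {0}) ∨
        (IsAddCyclic G ∧
          (∃ g g' : G, addOrderOf g = Nat.card G ∧
            S.map (fun s => -g' + s) = Multiset.replicate (Nat.card G - 2) 0 + {g, -g} ∧
            weightedSumset W S =
              Set.univ \ {((Nat.card G - 1) * Nat.card G / 2) • g'}) ∧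
          ∀ h : G, AddSubgroup.zmultiples h = ⊤ → h ∈ weightedSumset W S))) := by
  classical
  rw [inCosetOfProperSubgroup_iff, not_not] at hS
  obtain ⟨a, rfl⟩ := hW
  have hinj : Function.Injective (fun x => a • S.sum + x) := add_right_injective _
  rw [weightedSumset_consecutiveIntegers]
  have hfull : apSums S = Set.univ → (fun x => a • S.sum + x) '' apSums S = Set.univ := by
    intro h
    rw [h, Set.image_univ]
    exact (AddGroup.addLeft_bijective (a • S.sum)).surjective.range_eq
  refine ⟨?_, ?_, ?_⟩
  · rw [Set.ncard_image_of_injective _ hinj]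
    exact hasLowerBound G S hS
  · intro hc
    obtain ⟨T, hTS, hTc, hTX⟩ := hasFullSubsequence G S hS hc
    refine ⟨hfull (apSums_eq_univ_of_le hTS hTX), T, hTS, hTc, ?_⟩
    rw [← hTc]
    exact hTX
  · intro hc hX
    obtain ⟨hsum, hG3, hex⟩ := classification_of_apSums_ne_univ hS hc fun h => hX (hfull h)
    -- The sum of `S` is zero, so the first weight `a` is irrelevant.
    have hid : (fun x => a • S.sum + x) '' apSums S = apSums S := by
      rw [hsum]
      simp
    rw [hid] at hX ⊢
    have hmiss : ∀ p : G, (∀ x, x ≠ p → x ∈ apSums S) → apSums S = Set.univ \ {p} := by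
      intro p hp
      ext x
      simp only [Set.mem_sdiff, Set.mem_univ, Set.mem_singleton_iff, true_and]
      refine ⟨?_, hp x⟩
      rintro hx rfl
      refine hX (Set.eq_univ_of_forall fun y => ?_)
      by_cases hy : y = x
      · rwa [hy]
      · exact hp y hy
    refine ⟨hG3, ?_⟩
    rcases hex with ⟨hN, h2, hnd⟩ | ⟨c, g, hg, hSc⟩
    · left
      refine ⟨?_, ?_, hc.trans hN, hN,
        hmiss 0 fun x hx => mem_apSums_of_nodup hN (hc.trans hN) hnd h2 hsum hx⟩
      · have : IsAddKleinFour G := ⟨hN, by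
          refine (Nat.prime_two.eq_one_or_self_of_dvd _
            (AddMonoid.exponent_dvd_of_forall_nsmul_eq_zero fun x => ?_)).resolve_left ?_
          · rw [two_nsmul, h2]
          · intro h1
            have := (AddMonoid.exp_eq_one_iff.1 h1)
            have := Finite.card_le_one_iff_subsingleton.2 this
            omega⟩
        exact IsAddKleinFour.nonempty_addEquiv
      · have : {x : G | x ∈ S} = (S.toFinset : Set G) := by ext; simp
        rw [this, Set.ncard_coe_finset, Multiset.toFinset_card_of_nodup hnd, hc, hN]
    · right
      have hz : AddSubgroup.zmultiples g = ⊤ :=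
        AddSubgroup.eq_top_of_card_eq _ (by rw [Nat.card_zmultiples, hg])
      have hmem : ∀ x, x ≠ ((Nat.card G - 1) * Nat.card G / 2) • c → x ∈ apSums S := by
        intro x hx
        set p := ((Nat.card G - 1) * Nat.card G / 2) • c with hp
        have hxm : x - p ∈ AddSubgroup.zmultiples g := by rw [hz]; trivial
        rw [← mem_multiples_iff_mem_zmultiples, mem_multiples_iff_mem_range_addOrderOf,
          Finset.mem_image] at hxm
        obtain ⟨j, hj, hjx⟩ := hxm
        rw [Finset.mem_range, hg] at hj
        have h0 : 0 < j := by
          rw [Nat.pos_iff_ne_zero]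
          rintro rfl
          exact hx (sub_eq_zero.1 (by rw [← hjx, zero_smul]))
        have := add_nsmul_mem_apSums (by omega) hSc h0 hj
        rwa [← hp, hjx, add_sub_cancel] at this
      refine ⟨⟨g, fun x => by rw [← AddSubgroup.mem_zmultiples_iff, hz]; trivial⟩,
        ⟨g, c, hg, ?_, hmiss _ hmem⟩, fun h hh => hmem h ?_⟩
      · rw [hSc]
        simp [sub_eq_add_neg]
      · intro hhp
        -- Twice the missing element is a multiple of `|G| • c = 0`, while a generator has order at
        -- least three.
        have h2 : 2 • h = 0 := by
          have hev : 2 ∣ (Nat.card G - 1) * Nat.card G := by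
            rw [mul_comm]
            exact (Nat.even_mul_pred_self _).two_dvd
          rw [hhp, ← mul_nsmul', Nat.mul_div_cancel' hev, mul_nsmul', card_nsmul_eq_zero',
            smul_zero]
        have h4 := addOrderOf_dvd_of_nsmul_eq_zero h2
        rw [addOrderOf_eq_card_of_zmultiples_eq_top hh] at h4
        have := Nat.le_of_dvd (by norm_num) h4
        omega
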